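/- Let $d\ge 0$ and $n\ge 1$ be integers, and work in $\mathbb R^d$ with its Euclidean inner product and standard basis $e_1,\dots,e_d$. Write $\theta^2:=(\theta_j^2)_{j\le d}$. A set $A\subset\mathbb R^d$ is orthosymmetric if $(s_j\theta_j)_{j}\in A$ for all $\theta\in A$, $s\in\{\pm1\}^d$, and quadratically convex if $\{\theta^2:\theta\in A\}$ is convex; $\mathsf{QHull}(A)$ denotes the smallest orthosymmetric, convex and quadratically convex set containing $A$. Let $\Theta\subset\mathbb R^d$ be nonempty, orthosymmetric, quadratically convex, convex and compact, let $\gamma$ be an arbitrary norm on $\mathbb R^d$, and let $B_\gamma=\{x:\gamma(x)\le1\}$. For a measurable space $\mathcal X$ let $\mathcal F^{\gamma}_{\mathcal X}$ be the set of all $F:\mathbb R^d\times\mathcal X\to\mathbb R$ that are convex in the first argument, measurable in the second, and satisfy $\gamma(g)\le1$ for all $\theta\in\mathbb{R}^d$, $x\in\mathcal X$ and $g\in\partial_\theta F(\theta,x)$. For a probability measure $P$ on $\mathcal X$ put $f_P(\theta)=\int F(\theta,x)\,dP(x)$. Define $$\mathfrak M^{\mathsf S}_n(\Theta,\gamma)=\sup_{\mathcal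 X}\ \sup_{\mathcal P}\ \inf_{\hat\theta}\ \sup_{F\in\mathcal F^{\gamma}_{\mathcal X}}\ \sup_{P\in\mathcal P}\ \mathbf E\Big[f_P\big(\hat\theta(F;X_1,\dots,X_n)\big)-\inf_{\theta\in\Theta}f_P(\theta)\Big],$$ where $X_1,\dots,X_n$ are i.i.d. with law $P$, $\mathcal P$ ranges over all sets of probability measures on $\mathcal X$, the inner suprema run over the pairs $(F,P)$ such that $F(\theta,\cdot)$ is $P$-integrable for every $\theta$, the infimum is over all procedures $\hat\theta$ with values in $\mathbb R^d$ (not necessarily in $\Theta$) which may use the loss function $F$ and are measurable in the sample, and an expectation is $+\infty$ if its positive part is; and $$\mathfrak M^{\mathsf R}_n(\Theta,\gamma)=\sup_{\mathcal X}\ \inf_{\hat\theta_1,\dots,\hat\theta_n}\ \sup_{F\in\mathcal F^{\gamma}_{\mathcal X},\,x_1,\dots,x_n\in\mathcal X,\,\theta\in\Theta}\ \frac1n\sum_{i=1}^n\Big[F\big(\hat\theta_i(F;x_1,\dots,x_{i-1}),x_i\big)-F(\theta,x_i)\Big],$$ where each $\hat\theta_i$ is $\mathbb R^d$-valued, may use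 $F$, and is measurable in $(x_1,\dots,x_{i-1})$. Let $\|\theta\|_0$ be the number of nonzero coordinates of $\theta$ and $\big(\theta/\gamma(e_\cdot)\big)_j=\theta_j/\gamma(e_j)$. Then for every integer $k\ge0$, $$\frac{1}{8\sqrt{n\log 3}}\Big(1-\frac{k}{n\log3}\Big)\sup_{\theta\in\Theta,\ \|\theta\|_0\le k}\Big\|\frac{\theta}{\gamma(e_\cdot)}\Big\|_2\ \le\ \mathfrak M^{\mathsf S}_n(\Theta,\gamma)\ \le\ \mathfrak M^{\mathsf R}_n(\Theta,\gamma)\ \le\ \frac1{\sqrt n}\ \sup_{\theta\in\Theta}\ \sup_{g\in\mathsf{QHull}(B_\gamma)}\langle\theta,g\rangle .$$ -/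

import Mathlib

universe u

open MeasureTheory

noncomputable section

namespace QCMinimax

/-- `d`-dimensional Euclidean space. -/
abbrev E (d : ℕ) : Type := EuclideanSpace ℝ (Fin d)

/-! ### Geometry: orthosymmetry, quadratic convexity, quadratic hull -/

/-- `Θ` is invariant under flipping the signs of any coordinates. -/
def Orthosymmetric {d : ℕ} (Θ : Set (E d)) : Prop :=
  ∀ θ ∈ Θ, ∀ s : Fin d → ℝ, (∀ j, s j = 1 ∨ s j = -1) →
    WithLp.toLp 2 (fun j => s j * θ j) ∈ Θ

/-- The set `Θ² = {θ² : θ ∈ Θ}` of coordinatewise squares. -/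
def squareSet {d : ℕ} (Θ : Set (E d)) : Set (E d) :=
  (fun θ : E d => (WithLp.toLp 2 (fun j => θ j ^ 2) : E d)) '' Θ

/-- `Θ` is quadratically convex if `Θ²` is convex. -/
def QuadraticallyConvex {d : ℕ} (Θ : Set (E d)) : Prop :=
  Convex ℝ (squareSet Θ)

/-- The quadratic convex hull: the smallest orthosymmetric, convex and quadratically convex set
containing `S` (see `qHull_isLeast`). -/
def qHull {d : ℕ} (S : Set (E d)) : Set (E d) :=
  ⋂₀ {A | S ⊆ A ∧ Orthosymmetric A ∧ Convex ℝ A ∧ QuadraticallyConvex A}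

theorem qHull_isLeast {d : ℕ} (S : Set (E d)) :
    IsLeast {A | S ⊆ A ∧ Orthosymmetric A ∧ Convex ℝ A ∧ QuadraticallyConvex A} (qHull S) := by
  refine ⟨⟨?_, ?_, ?_, ?_⟩, fun A hA => Set.sInter_subset_of_mem hA⟩
  · exact Set.subset_sInter fun A hA => hA.1
  · intro θ hθ s hs A hA
    exact hA.2.1 θ (hθ A hA) s hs
  · exact convex_sInter fun A hA => hA.2.2.1
  · rintro _ ⟨θ, hθ, rfl⟩ _ ⟨τ, hτ, rfl⟩ a b ha hb hab
    refine ⟨WithLp.toLp 2 (fun j => √(a * θ j ^ 2 + b * τ j ^ 2)), ?_, ?_⟩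
    · intro A hA
      obtain ⟨v, hv, hv'⟩ := hA.2.2.2 ⟨θ, hθ A hA, rfl⟩ ⟨τ, hτ A hA, rfl⟩ ha hb hab
      have key := hA.2.1 v hv (fun j => if 0 ≤ v j then 1 else -1)
        (fun j => by by_cases h : 0 ≤ v j <;> simp [h])
      convert key using 2
      funext j
      have hj : v j ^ 2 = a * θ j ^ 2 + b * τ j ^ 2 := by
        have := congrArg (fun w : E d => w j) hv'
        simpa using this
      rw [← hj, Real.sqrt_sq_eq_abs]
      by_cases h : 0 ≤ v j
      · simp [h, abs_of_nonneg h]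
      · simp [h, abs_of_neg (not_le.mp h)]
    · ext j
      have : 0 ≤ a * θ j ^ 2 + b * τ j ^ 2 := by positivity
      simp [Real.sq_sqrt this]

/-- The closed ball of radius `r` around `x₀` for the norm `γ`. -/
def normBall {d : ℕ} (γ : Seminorm ℝ (E d)) (x₀ : E d) (r : ℝ) : Set (E d) :=
  {x | γ (x - x₀) ≤ r}

/-- The number `‖θ‖₀` of nonzero coordinates. -/
def l0 {d : ℕ} (θ : E d) : ℕ := (Finset.univ.filter fun j => θ j ≠ 0).card

/-- The vector `θ / γ(e_·)`, with coordinates `θ_j / γ(e_j)`. -/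
def scaled {d : ℕ} (γ : Seminorm ℝ (E d)) (θ : E d) : E d :=
  WithLp.toLp 2 (fun j => θ j / γ (EuclideanSpace.single j 1))

/-! ### The loss functions -/

/-- The subdifferential of a convex function `f` at `θ`. -/
def subdifferential {d : ℕ} (f : E d → ℝ) (θ : E d) : Set (E d) :=
  {g | ∀ θ' : E d, f θ + inner ℝ g (θ' - θ) ≤ f θ'}

/-- The family of losses `F(θ, x)`, convex in `θ` and measurable in `x`, all of whose
subgradients in `θ` have `γ`-norm at most `r`. -/
def lossFamily {d : ℕ} (γ : Seminorm ℝ (E d)) (r : ℝ) (𝒳 : Type u) [MeasurableSpace 𝒳] :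
    Set (E d → 𝒳 → ℝ) :=
  {F | (∀ x, ConvexOn ℝ Set.univ fun θ => F θ x) ∧ (∀ θ, Measurable (F θ)) ∧
    ∀ x θ, ∀ g ∈ subdifferential (fun θ => F θ x) θ, γ g ≤ r}

/-! ### Minimax risk and minimax regret -/

/-- The expected loss `f_P(θ) = ∫ F(θ, x) dP(x)`. -/
def expectedLoss {d : ℕ} {𝒳 : Type u} [MeasurableSpace 𝒳] (F : E d → 𝒳 → ℝ)
    (P : ProbabilityMeasure 𝒳) (θ : E d) : ℝ :=
  ∫ x, F θ x ∂(P : Measure 𝒳)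

open Classical in
/-- The expectation of a real random variable `f` as an extended real number `E[f⁺] - E[f⁻]`,
with value `+∞` when `E[f⁺] = ∞`. -/
def extExpectation {Ω : Type u} [MeasurableSpace Ω] (μ : Measure Ω) (f : Ω → ℝ) : EReal :=
  if ∫⁻ ω, ENNReal.ofReal (f ω) ∂μ = ⊤ then ⊤
  else ((∫⁻ ω, ENNReal.ofReal (f ω) ∂μ : ENNReal) : EReal)
    - ((∫⁻ ω, ENNReal.ofReal (-f ω) ∂μ : ENNReal) : EReal)

/-- The minimax stochastic risk for a family `ℱ` of losses and a family `Ps` of distributions.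
A procedure `est` knows the loss `F` and observes a sample `X₁, …, Xₙ`; it is measurable in the
sample and need not take values in `Θ`. The supremum runs over the pairs `(F, P)` for which the
expected loss is defined. -/
def minimaxRiskOf {d : ℕ} (n : ℕ) (Θ : Set (E d)) {𝒳 : Type u} [MeasurableSpace 𝒳]
    (ℱ : Set (E d → 𝒳 → ℝ)) (Ps : Set (ProbabilityMeasure 𝒳)) : EReal :=
  ⨅ (est : (E d → 𝒳 → ℝ) → (Fin n → 𝒳) → E d) (_ : ∀ F ∈ ℱ, Measurable (est F)),
    ⨆ F ∈ ℱ, ⨆ P ∈ Ps, ⨆ (_ : ∀ θ, Integrable (F θ) (P : Measure 𝒳)),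
      extExpectation (Measure.pi fun _ : Fin n => (P : Measure 𝒳)) fun X =>
        expectedLoss F P (est F X) - ⨅ θ : Θ, expectedLoss F P θ

/-- The average minimax regret for a family `ℱ` of losses. The `i`-th decision of an algorithm
`alg` is a measurable function of the preceding observations `x₁, …, x_{i-1}`; the algorithm
knows the loss `F`, and its decisions need not lie in `Θ`. -/
def minimaxRegretOf {d : ℕ} (n : ℕ) (Θ : Set (E d)) {𝒳 : Type u} [MeasurableSpace 𝒳]
    (ℱ : Set (E d → 𝒳 → ℝ)) : EReal :=
  ⨅ (alg : (E d → 𝒳 → ℝ) → (i : Fin n) → (Fin i → 𝒳) → E d)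
    (_ : ∀ F ∈ ℱ, ∀ i, Measurable (alg F i)),
    ⨆ F ∈ ℱ, ⨆ x : Fin n → 𝒳, ⨆ θ ∈ Θ,
      (((1 / (n : ℝ)) * ∑ i : Fin n,
        (F (alg F i fun j => x (Fin.castLE i.isLt.le j)) (x i) - F θ (x i)) : ℝ) : EReal)

/-- The minimax stochastic risk for `γ`: supremum over all sample spaces `𝒳` and all families of
distributions on `𝒳`. -/
def minimaxRisk {d : ℕ} (n : ℕ) (Θ : Set (E d)) (γ : Seminorm ℝ (E d)) : EReal :=
  ⨆ (𝒳 : Type u) (_ : MeasurableSpace 𝒳) (Ps : Set (ProbabilityMeasure 𝒳)),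
    minimaxRiskOf n Θ (lossFamily γ 1 𝒳) Ps

/-- The minimax regret for `γ`: supremum over all sample spaces `𝒳`. -/
def minimaxRegret {d : ℕ} (n : ℕ) (Θ : Set (E d)) (γ : Seminorm ℝ (E d)) : EReal :=
  ⨆ (𝒳 : Type u) (_ : MeasurableSpace 𝒳), minimaxRegretOf n Θ (lossFamily γ 1 𝒳)

end QCMinimax

end

noncomputable section

namespace QCMinimax

/-! ### Subgradients of finite convex functions -/

/-! Regret upper bound. Let `s` bound `⟨θ, g⟩` on `Θ` and the quadratic hull of the `γ`-ball. By
orthosymmetry, `∑ √(u_j v_j) ≤ s` for all squares `u`, `v` of such vectors. Each `√(u_j v_j)` is the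
minimum over `c_j > 0` of `(u_j / c_j + c_j v_j) / 2`. Quadratic convexity makes both sets of
squares convex, and the sum of geometric means is concave, so minimum and supremum can be exchanged:
one scaling `c` serves all `θ` and `g` up to `ε` (`exists_scaling_of_sum_sqrt_le`,
`exists_scaling`). Subgradient descent with coordinatewise steps `c_j / √n` then has average regret
close to `s / √n` (`sum_scaledDescent_add_le`, `minimaxRegretOf_le`).

Risk versus regret. Averaging the iterates of an online algorithm over an i.i.d. sample turns regret
into excess risk, by Jensen and independence (`extExpectation_average_le`). An arbitrary algorithm
may produce losses that are not integrable; quantizing its observations makes its decisions bounded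
at arbitrarily small cost in regret (`lossFamily.exists_bounded_algorithm`).

Lower bound. The data are a random coordinate `j`, of probability `p j`, and a sign of mean `± δ j`;
the loss is a scaled absolute deviation in that coordinate. A small excess risk forces the procedure
to recover the unknown signs. If `n p_j δ_j²` is small, the product laws for the two signs of
coordinate `j` overlap, so that sign is missed with average probability at least `1/4`
(`quarter_le_sum_signError`, `sum_le_minimaxRisk`). Taking `p` proportional to the squares of `θ_j /
γ(e_j)` gives the stated norm; coordinates of too small weight are dropped, which costs the factor
involving `k` (`mul_norm_scaled_le_minimaxRisk`). -/

lemma continuous_of_convexOn_univ {d : ℕ} {f : E d → ℝ} (hf : ConvexOn ℝ Set.univ f) :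
    Continuous f :=
  continuousOn_univ.1 (hf.continuousOn isOpen_univ)

/-- A finite convex function has a subgradient at every point. -/
lemma subdifferential_nonempty {d : ℕ} {f : E d → ℝ} (hf : ConvexOn ℝ Set.univ f) (θ : E d) :
    (subdifferential f θ).Nonempty := by
  have hcont := continuous_of_convexOn_univ hf
  have hopen : IsOpen {p : E d × ℝ | f p.1 < p.2} :=
    isOpen_lt (hcont.comp continuous_fst) continuous_snd
  have hconv : Convex ℝ {p : E d × ℝ | f p.1 < p.2} := by
    simpa using hf.convex_strict_epigraph
  -- Separate the open strict epigraph from the boundary point above `θ`. The vertical coefficient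
  -- `c` of the functional is negative, so dividing by `-c` turns its horizontal part into a
  -- subgradient.
  obtain ⟨φ, hφ⟩ := geometric_hahn_banach_open_point hconv hopen
    (x := (θ, f θ)) (by simp)
  set c : ℝ := φ (0, 1) with hc
  have hsplit : ∀ (x : E d) (t : ℝ), φ (x, t) = φ (x, 0) + t * c := by
    intro x t
    have : ((x, t) : E d × ℝ) = (x, 0) + t • (0, 1) := by simp
    rw [this, map_add, map_smul, smul_eq_mul]
  have hcneg : c < 0 := by
    have h := hφ (θ, f θ + 1) (by simp)
    rw [hsplit θ (f θ + 1), hsplit θ (f θ)] at h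
    linarith
  have hle : ∀ x, φ (x, 0) + f x * c ≤ φ (θ, 0) + f θ * c := by
    intro x
    refine le_of_forall_pos_le_add fun ε hε => ?_
    have h := hφ (x, f x + ε / (-c)) (by
      have : 0 < ε / (-c) := div_pos hε (by linarith)
      simpa using this)
    rw [hsplit x, hsplit θ] at h
    have hc0 : c ≠ 0 := hcneg.ne
    have : ε / (-c) * c = -ε := by field_simp
    nlinarith
  let ψ : StrongDual ℝ (E d) := (-c)⁻¹ • (φ.comp (ContinuousLinearMap.inl ℝ (E d) ℝ))
  refine ⟨(InnerProductSpace.toDual ℝ (E d)).symm ψ, fun x => ?_⟩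
  rw [InnerProductSpace.toDual_symm_apply]
  have h := hle x
  have hψ : ψ (x - θ) = (-c)⁻¹ * (φ (x, 0) - φ (θ, 0)) := by
    rw [← map_sub, Prod.mk_sub_mk, sub_zero]
    rfl
  rw [hψ]
  have hc' : 0 < -c := by linarith
  have : (-c)⁻¹ * (φ (x, 0) - φ (θ, 0)) ≤ (-c)⁻¹ * ((-c) * (f x - f θ)) :=
    mul_le_mul_of_nonneg_left (by linarith) (inv_nonneg.2 hc'.le)
  rw [inv_mul_cancel_left₀ hc'.ne'] at this
  linarith

/-! ### Comparison of a norm with the Euclidean norm -/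

lemma continuous_seminorm {d : ℕ} (γ : Seminorm ℝ (E d)) : Continuous γ :=
  continuous_of_convexOn_univ γ.convexOn

/-- A norm on `ℝ^d` dominates a multiple of the Euclidean norm. -/
lemma exists_norm_le_mul {d : ℕ} (γ : Seminorm ℝ (E d)) (hγ : ∀ x, γ x = 0 → x = 0) :
    ∃ L : ℝ, 0 < L ∧ ∀ g, ‖g‖ ≤ L * γ g := by
  rcases (Metric.sphere (0 : E d) 1).eq_empty_or_nonempty with h | h
  · refine ⟨1, one_pos, fun g => ?_⟩
    have hg : g = 0 := by
      by_contra hne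
      have : (‖g‖⁻¹ : ℝ) • g ∈ Metric.sphere (0 : E d) 1 := by
        simp [norm_smul, hne]
      rw [h] at this
      exact this
    simp [hg]
  · obtain ⟨x, hx, hmin⟩ := (isCompact_sphere (0 : E d) 1).exists_isMinOn h
      (continuous_seminorm γ).continuousOn
    have hx0 : x ≠ 0 := by
      rintro rfl
      simp at hx
    have hpos : 0 < γ x := lt_of_le_of_ne (apply_nonneg γ x) fun h0 => hx0 (hγ x h0.symm)
    refine ⟨(γ x)⁻¹, inv_pos.2 hpos, fun g => ?_⟩
    rcases eq_or_ne g 0 with rfl | hg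
    · simp
    have hg' : 0 < ‖g‖ := norm_pos_iff.2 hg
    have hmem : (‖g‖⁻¹ : ℝ) • g ∈ Metric.sphere (0 : E d) 1 := by
      simp [norm_smul, hg]
    have hle : γ x ≤ γ ((‖g‖⁻¹ : ℝ) • g) := hmin hmem
    rw [map_smul_eq_mul, norm_inv, norm_norm, inv_mul_eq_div, le_div_iff₀ hg'] at hle
    rw [inv_mul_eq_div, le_div_iff₀ hpos]
    linarith

/-! ### Regularity of the losses -/

section LossFamily

variable {d : ℕ} {γ : Seminorm ℝ (E d)} {𝒳 : Type u} [MeasurableSpace 𝒳] {F : E d → 𝒳 → ℝ}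

lemma lossFamily.continuous (hF : F ∈ lossFamily γ 1 𝒳) (x : 𝒳) : Continuous fun θ => F θ x :=
  continuous_of_convexOn_univ (hF.1 x)

/-- Subgradients exist everywhere and have bounded Euclidean norm, since all norms on `ℝ^d` are
comparable. The constant does not depend on the observation. -/
lemma lossFamily.exists_lipschitz (hγ : ∀ x, γ x = 0 → x = 0) (hF : F ∈ lossFamily γ 1 𝒳) :
    ∃ L : ℝ, 0 < L ∧ ∀ x θ θ', |F θ x - F θ' x| ≤ L * ‖θ - θ'‖ := by
  obtain ⟨L, hL, hle⟩ := exists_norm_le_mul γ hγ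
  have key : ∀ x θ θ', F θ x - F θ' x ≤ L * ‖θ - θ'‖ := by
    intro x θ θ'
    obtain ⟨g, hg⟩ := subdifferential_nonempty (hF.1 x) θ
    have h1 := hg θ'
    have h2 := abs_real_inner_le_norm g (θ' - θ)
    have h3 : ‖g‖ ≤ L := (hle g).trans (by
      have := hF.2.2 x θ g hg
      nlinarith)
    rw [norm_sub_rev θ θ']
    have h4 := neg_le_of_abs_le h2
    have h5 : ‖g‖ * ‖θ' - θ‖ ≤ L * ‖θ' - θ‖ := mul_le_mul_of_nonneg_right h3 (norm_nonneg _)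
    simp only at h1
    linarith
  refine ⟨L, hL, fun x θ θ' => abs_le.2 ⟨?_, key x θ θ'⟩⟩
  have := key x θ' θ
  rw [norm_sub_rev] at this
  linarith

lemma lossFamily.measurable_uncurry (hF : F ∈ lossFamily γ 1 𝒳) :
    Measurable (Function.uncurry F) :=
  measurable_uncurry_of_continuous_of_measurable (fun x => lossFamily.continuous hF x) hF.2.1

/-- A measurable choice of approximate subgradients in the unit ball of `γ`. -/
lemma lossFamily.exists_measurable_approx_subgradient (hF : F ∈ lossFamily γ 1 𝒳)
    {Θ : Set (E d)} (hne : Θ.Nonempty) (hbdd : Bornology.IsBounded Θ) {ε : ℝ} (hε : 0 < ε) :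
    ∃ sel : E d × 𝒳 → E d, Measurable sel ∧ (∀ p, γ (sel p) ≤ 1) ∧
      ∀ θ x, ∀ τ ∈ Θ, F θ x + inner ℝ (sel (θ, x)) (τ - θ) ≤ F τ x + ε := by
  classical
  have : Nonempty Θ := hne.to_subtype
  have : Nonempty {g : E d // γ g ≤ 1} := ⟨⟨0, by simp⟩⟩
  -- With countable dense sets of candidate subgradients and of comparison points, admissibility of
  -- the `m`-th candidate becomes a countable intersection of measurable conditions. The slack `ε`
  -- guarantees that some candidate is admissible, and choosing the first such index is measurable.
  let b : ℕ → {g : E d // γ g ≤ 1} := TopologicalSpace.denseSeq _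
  let t : ℕ → Θ := TopologicalSpace.denseSeq _
  let p : ℕ → E d × 𝒳 → Prop := fun m q =>
    ∀ k, F q.1 q.2 + inner ℝ (b m : E d) ((t k : E d) - q.1) ≤ F (t k) q.2 + ε
  have hp : ∀ q, ∃ m, p m q := by
    rintro ⟨θ, x⟩
    obtain ⟨g, hg⟩ := subdifferential_nonempty (hF.1 x) θ
    obtain ⟨R, hR⟩ := hbdd.exists_norm_le
    have hR0 : 0 ≤ R := by
      obtain ⟨τ, hτ⟩ := hne
      exact (norm_nonneg τ).trans (hR τ hτ)
    have hpos : 0 < R + ‖θ‖ + 1 := by positivity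
    obtain ⟨m, hm⟩ := (TopologicalSpace.denseRange_denseSeq {g : E d // γ g ≤ 1}).exists_dist_lt
      ⟨g, hF.2.2 x θ g hg⟩ (div_pos hε hpos)
    refine ⟨m, fun k => ?_⟩
    have h1 := hg (t k)
    have h2 : ‖(b m : E d) - g‖ ≤ ε / (R + ‖θ‖ + 1) := by
      rw [← dist_eq_norm, dist_comm]
      exact hm.le
    have h3 : ‖(t k : E d) - θ‖ ≤ R + ‖θ‖ + 1 := by
      have := norm_sub_le (t k : E d) θ
      have := hR _ (t k).2
      linarith
    have h4 : inner ℝ ((b m : E d) - g) ((t k : E d) - θ) ≤ ε := by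
      calc inner ℝ ((b m : E d) - g) ((t k : E d) - θ)
          ≤ ‖(b m : E d) - g‖ * ‖(t k : E d) - θ‖ := real_inner_le_norm _ _
        _ ≤ ε / (R + ‖θ‖ + 1) * (R + ‖θ‖ + 1) := by gcongr
        _ = ε := div_mul_cancel₀ _ hpos.ne'
    rw [inner_sub_left] at h4
    simp only at h1 ⊢
    linarith
  have hFm := lossFamily.measurable_uncurry hF
  refine ⟨fun q => b (Nat.find (hp q)), ?_, fun q => (b _).2, ?_⟩
  · refine Measurable.find (f := fun m _ => (b m : E d)) (fun m => measurable_const)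
      (fun m => ?_) hp
    simp only [p, Set.ofPred_forall]
    refine MeasurableSet.iInter fun k => measurableSet_le ?_ ?_
    · refine hFm.add ?_
      exact (Continuous.measurable (by fun_prop : Continuous fun θ : E d =>
        (inner ℝ (b m : E d) ((t k : E d) - θ) : ℝ))).comp measurable_fst
    · exact ((hF.2.1 (t k)).comp measurable_snd).add_const ε
  · intro θ x τ hτ
    have hspec := Nat.find_spec (hp (θ, x))
    set m := Nat.find (hp (θ, x))
    have hcl : IsClosed {τ : Θ | F θ x + inner ℝ (b m : E d) ((τ : E d) - θ) ≤ F τ x + ε} := by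
      refine isClosed_le (by fun_prop) ?_
      exact ((lossFamily.continuous hF x).comp continuous_subtype_val).add continuous_const
    have hsub := hcl.closure_subset_iff.2 (Set.range_subset_iff.2 hspec)
    rw [(TopologicalSpace.denseRange_denseSeq Θ).closure_range] at hsub
    exact hsub (Set.mem_univ (⟨τ, hτ⟩ : Θ))

end LossFamily

/-! ### The saddle point bound for diagonal scalings -/

/-- First-order condition for a maximum of a sum of geometric means along a segment. -/
lemma sum_scaled_le_zero_of_isMax {ι : Type*} [Fintype ι] {a b α β : ι → ℝ}
    (ha : ∀ j, 0 < a j) (hb : ∀ j, 0 < b j)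
    (hmax : ∀ t ∈ Set.Ioc (0 : ℝ) 1,
      ∑ j, √((a j + t * α j) * (b j + t * β j)) ≤ ∑ j, √(a j * b j)) :
    ∑ j, (α j / (√(a j) / √(b j)) + √(a j) / √(b j) * β j) ≤ 0 := by
  have hderiv : HasDerivAt (fun t : ℝ => ∑ j, √((a j + t * α j) * (b j + t * β j)))
      (∑ j, (α j * b j + a j * β j) / (2 * √(a j * b j))) 0 := by
    refine HasDerivAt.fun_sum fun j _ => ?_
    have h1 : HasDerivAt (fun t : ℝ => a j + t * α j) (α j) 0 := by
      simpa using ((hasDerivAt_id (0 : ℝ)).mul_const (α j)).const_add (a j)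
    have h2 : HasDerivAt (fun t : ℝ => b j + t * β j) (β j) 0 := by
      simpa using ((hasDerivAt_id (0 : ℝ)).mul_const (β j)).const_add (b j)
    have h3 := (h1.mul h2).sqrt (by simpa using ⟨(ha j).ne', (hb j).ne'⟩)
    simpa using h3
  -- Only the derivative from the right is available: the maximum is known for `t` in `(0, 1]`
  -- alone.
  have hslope := (hasDerivWithinAt_iff_tendsto_slope' (Set.self_notMem_Ioi)).1
    (hderiv.hasDerivWithinAt (s := Set.Ioi 0))
  have hle : ∑ j, (α j * b j + a j * β j) / (2 * √(a j * b j)) ≤ 0 := by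
    refine le_of_tendsto hslope ?_
    filter_upwards [Ioc_mem_nhdsGT (zero_lt_one' ℝ)] with t ht
    have := hmax t ht
    rw [slope_def_field]
    refine div_nonpos_of_nonpos_of_nonneg ?_ (by simpa using ht.1.le)
    simpa using this
  have hEq : ∑ j, (α j / (√(a j) / √(b j)) + √(a j) / √(b j) * β j)
      = 2 * ∑ j, (α j * b j + a j * β j) / (2 * √(a j * b j)) := by
    rw [Finset.mul_sum]
    refine Finset.sum_congr rfl fun j _ => ?_
    have h1 := Real.sqrt_pos.2 (ha j)
    have h2 := Real.sqrt_pos.2 (hb j)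
    rw [Real.sqrt_mul (ha j).le]
    have e1 : b j = √(b j) * √(b j) := (Real.mul_self_sqrt (hb j).le).symm
    have e2 : a j = √(a j) * √(a j) := (Real.mul_self_sqrt (ha j).le).symm
    set p := √(a j)
    set q := √(b j)
    rw [e1, e2]
    field_simp
  rw [hEq]
  linarith

lemma sqrt_add_mul_add_le {u v M δ : ℝ} (hu : 0 ≤ u) (hv : 0 ≤ v) (huM : u ≤ M) (hvM : v ≤ M)
    (hδ : 0 ≤ δ) : √((u + δ) * (v + δ)) ≤ √(u * v) + √(δ * (2 * M + δ)) := by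
  refine Real.sqrt_le_iff.2 ⟨by positivity, ?_⟩
  have h1 : √(u * v) ^ 2 = u * v := Real.sq_sqrt (by positivity)
  have h2 : √(δ * (2 * M + δ)) ^ 2 = δ * (2 * M + δ) :=
    Real.sq_sqrt (mul_nonneg hδ (by linarith))
  have h3 : 0 ≤ √(u * v) * √(δ * (2 * M + δ)) := by positivity
  nlinarith

/-- If `∑ √(u_j v_j) ≤ s` on a product of convex compact sets of nonnegative vectors, then a single
diagonal scaling almost attains the arithmetic-geometric mean inequality uniformly. -/
lemma exists_scaling_of_sum_sqrt_le {d : ℕ} {U V : Set (E d)} (hU : Convex ℝ U) (hV : Convex ℝ V)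
    (hUc : IsCompact U) (hVc : IsCompact V) (hU0 : ∀ u ∈ U, ∀ j, 0 ≤ u j)
    (hV0 : ∀ v ∈ V, ∀ j, 0 ≤ v j) {s : ℝ} (hs : ∀ u ∈ U, ∀ v ∈ V, ∑ j, √(u j * v j) ≤ s)
    {ε : ℝ} (hε : 0 < ε) :
    ∃ c : Fin d → ℝ, (∀ j, 0 < c j) ∧
      ∀ u ∈ U, ∀ v ∈ V, 1 / 2 * ∑ j, (u j / c j + c j * v j) ≤ s + ε := by
  rcases (U ×ˢ V).eq_empty_or_nonempty with hem | hne
  · refine ⟨fun _ => 1, fun _ => one_pos, fun u hu v hv => ?_⟩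
    have : (u, v) ∈ U ×ˢ V := ⟨hu, hv⟩
    simp [hem] at this
  obtain ⟨M₁, hM₁⟩ := hUc.isBounded.exists_norm_le
  obtain ⟨M₂, hM₂⟩ := hVc.isBounded.exists_norm_le
  set M := max M₁ M₂
  have hUM : ∀ u ∈ U, ∀ j, u j ≤ M := fun u hu j =>
    (le_abs_self _).trans ((PiLp.norm_apply_le u j).trans ((hM₁ u hu).trans (le_max_left _ _)))
  have hVM : ∀ v ∈ V, ∀ j, v j ≤ M := fun v hv j =>
    (le_abs_self _).trans ((PiLp.norm_apply_le v j).trans ((hM₂ v hv).trans (le_max_right _ _)))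
  -- Shifting all coordinates by `δ` keeps them away from zero, so the geometric means are
  -- differentiable and the scaling is positive. The total price of the shift stays below `ε`.
  obtain ⟨δ, hδ, hδε⟩ : ∃ δ : ℝ, 0 < δ ∧ d * √(δ * (2 * M + δ)) ≤ ε := by
    have hc : Continuous fun δ : ℝ => d * √(δ * (2 * M + δ)) := by fun_prop
    have hlt : ∀ᶠ δ : ℝ in nhds 0, d * √(δ * (2 * M + δ)) < ε :=
      hc.continuousAt.eventually_lt continuousAt_const (by simpa using hε)
    obtain ⟨δ, h1, h2⟩ := ((hlt.filter_mono nhdsWithin_le_nhds).and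
      (self_mem_nhdsWithin (s := Set.Ioi (0 : ℝ)))).exists
    exact ⟨δ, h2, h1.le⟩
  obtain ⟨⟨u', v'⟩, ⟨hu', hv'⟩, hmax⟩ := (hUc.prod hVc).exists_isMaxOn hne
    (f := fun p : E d × E d => ∑ j, √((p.1 j + δ) * (p.2 j + δ)))
    (by fun_prop : Continuous _).continuousOn
  have ha : ∀ j, 0 < u' j + δ := fun j => by linarith [hU0 u' hu' j]
  have hb : ∀ j, 0 < v' j + δ := fun j => by linarith [hV0 v' hv' j]
  -- This scaling gives equality in the arithmetic-geometric mean inequality at the shifted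
  -- maximizer. Moving towards any other `(u, v)` stays in the product by convexity, and the
  -- first-order condition along that segment extends the bound to `(u, v)`.
  refine ⟨fun j => √(u' j + δ) / √(v' j + δ), fun j =>
    div_pos (Real.sqrt_pos.2 (ha j)) (Real.sqrt_pos.2 (hb j)), fun u hu v hv => ?_⟩
  have hfirst := sum_scaled_le_zero_of_isMax ha hb
    (α := fun j => u j - u' j) (β := fun j => v j - v' j) (fun t ht => by
      have hmem : ((1 - t) • u' + t • u, (1 - t) • v' + t • v) ∈ U ×ˢ V :=
        ⟨hU hu' hu (by linarith [ht.2]) ht.1.le (by ring),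
          hV hv' hv (by linarith [ht.2]) ht.1.le (by ring)⟩
      have hle := hmax hmem
      simp only [Set.mem_ofPred_eq] at hle
      refine le_trans (le_of_eq (Finset.sum_congr rfl fun j _ => ?_)) hle
      congr 1
      simp only [PiLp.add_apply, PiLp.smul_apply, smul_eq_mul]
      ring)
  have hval : ∑ j, √((u' j + δ) * (v' j + δ)) ≤ s + ε := by
    calc ∑ j, √((u' j + δ) * (v' j + δ))
        ≤ ∑ j, (√(u' j * v' j) + √(δ * (2 * M + δ))) := Finset.sum_le_sum fun j _ =>
          sqrt_add_mul_add_le (hU0 u' hu' j) (hV0 v' hv' j) (hUM u' hu' j) (hVM v' hv' j) hδ.le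
      _ = ∑ j, √(u' j * v' j) + d * √(δ * (2 * M + δ)) := by
          rw [Finset.sum_add_distrib]
          simp
      _ ≤ s + ε := add_le_add (hs u' hu' v' hv') hδε
  have hterm : ∀ j, u j / (√(u' j + δ) / √(v' j + δ)) + √(u' j + δ) / √(v' j + δ) * v j
      ≤ ((u j - u' j) / (√(u' j + δ) / √(v' j + δ))
        + √(u' j + δ) / √(v' j + δ) * (v j - v' j)) + 2 * √((u' j + δ) * (v' j + δ)) := by
    intro j
    have h1 := Real.sqrt_pos.2 (ha j)
    have h2 := Real.sqrt_pos.2 (hb j)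
    rw [Real.sqrt_mul (ha j).le]
    have e1 : √(v' j + δ) * √(v' j + δ) = v' j + δ := Real.mul_self_sqrt (hb j).le
    have e2 : √(u' j + δ) * √(u' j + δ) = u' j + δ := Real.mul_self_sqrt (ha j).le
    set p := √(u' j + δ)
    set q := √(v' j + δ)
    have h3 : u' j / (p / q) ≤ p * q := by
      rw [div_le_iff₀ (by positivity)]
      have : p * q * (p / q) = p * p := by field_simp
      linarith
    have h4 : p / q * v' j ≤ p * q := by
      rw [div_mul_eq_mul_div, div_le_iff₀ h2]
      nlinarith
    rw [sub_div, mul_sub]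
    linarith
  have hsum := Finset.sum_le_sum fun j (_ : j ∈ Finset.univ) => hterm j
  rw [Finset.sum_add_distrib (g := fun j => 2 * √((u' j + δ) * (v' j + δ))),
    ← Finset.mul_sum] at hsum
  simp only
  linarith

/-! ### Bounds on the quadratic hull -/

/-- The cube of half-width `R` is itself orthosymmetric, convex and quadratically convex, hence one
of the sets whose intersection is the hull. -/
lemma abs_apply_le_of_mem_qHull {d : ℕ} {S : Set (E d)} {R : ℝ} (hR : ∀ x ∈ S, ∀ j, |x j| ≤ R)
    {x : E d} (hx : x ∈ qHull S) (j : Fin d) : |x j| ≤ R := by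
  have hR0 : ∀ x ∈ {x : E d | ∀ j, |x j| ≤ R}, ∀ j, x j ^ 2 ≤ R ^ 2 := fun x hx j =>
    sq_le_sq' (neg_le_of_abs_le (hx j)) (le_of_abs_le (hx j))
  have hsub : qHull S ⊆ {x : E d | ∀ j, |x j| ≤ R} := by
    refine (qHull_isLeast S).2 ⟨hR, ?_, ?_, ?_⟩
    · intro θ hθ s hs j
      rcases hs j with h | h <;> simpa [h] using hθ j
    · intro θ hθ τ hτ a b ha hb hab j
      simp only [PiLp.add_apply, PiLp.smul_apply, smul_eq_mul]
      calc |a * θ j + b * τ j| ≤ |a * θ j| + |b * τ j| := abs_add_le _ _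
        _ = a * |θ j| + b * |τ j| := by rw [abs_mul, abs_mul, abs_of_nonneg ha, abs_of_nonneg hb]
        _ ≤ a * R + b * R :=
          add_le_add (mul_le_mul_of_nonneg_left (hθ j) ha) (mul_le_mul_of_nonneg_left (hτ j) hb)
        _ = R := by rw [← add_mul, hab, one_mul]
    · rintro _ ⟨θ, hθ, rfl⟩ _ ⟨τ, hτ, rfl⟩ a b ha hb hab
      refine ⟨WithLp.toLp 2 (fun j => √(a * θ j ^ 2 + b * τ j ^ 2)), fun j => ?_, ?_⟩
      · have hRj : 0 ≤ R := (abs_nonneg _).trans (hθ j)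
        simp only [abs_of_nonneg (Real.sqrt_nonneg _)]
        refine Real.sqrt_le_iff.2 ⟨hRj, ?_⟩
        have h1 := mul_le_mul_of_nonneg_left (hR0 θ hθ j) ha
        have h2 := mul_le_mul_of_nonneg_left (hR0 τ hτ j) hb
        calc a * θ j ^ 2 + b * τ j ^ 2 ≤ a * R ^ 2 + b * R ^ 2 := add_le_add h1 h2
          _ = R ^ 2 := by rw [← add_mul, hab, one_mul]
      · ext j
        have : 0 ≤ a * θ j ^ 2 + b * τ j ^ 2 := by positivity
        simp [Real.sq_sqrt this]
  exact hsub hx j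

lemma exists_bound_qHull_normBall {d : ℕ} (γ : Seminorm ℝ (E d)) (hγ : ∀ x, γ x = 0 → x = 0) :
    ∃ R : ℝ, 0 < R ∧ ∀ g ∈ qHull (normBall γ 0 1), ∀ j, |g j| ≤ R := by
  obtain ⟨L, hL, hle⟩ := exists_norm_le_mul γ hγ
  refine ⟨L, hL, fun g hg j => abs_apply_le_of_mem_qHull (fun x hx j => ?_) hg j⟩
  have h1 : γ x ≤ 1 := by simpa [normBall] using hx
  calc |x j| ≤ ‖x‖ := PiLp.norm_apply_le x j
    _ ≤ L * γ x := hle x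
    _ ≤ L := by nlinarith

/-- Orthosymmetry turns a bound on inner products into a bound on `∑ |θ_j| |g_j|`. -/
lemma sum_abs_mul_abs_le {d : ℕ} {Θ : Set (E d)} (hΘ : Orthosymmetric Θ) {g : E d} {s : ℝ}
    (hs : ∀ θ ∈ Θ, inner ℝ θ g ≤ s) {θ : E d} (hθ : θ ∈ Θ) : ∑ j, |θ j| * |g j| ≤ s := by
  refine le_trans (le_of_eq ?_) (hs _ (hΘ θ hθ (fun j => if 0 ≤ θ j * g j then 1 else -1)
    (fun j => by split_ifs <;> simp)))
  rw [PiLp.inner_apply]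
  refine Finset.sum_congr rfl fun j _ => ?_
  rw [← abs_mul]
  by_cases h : 0 ≤ θ j * g j
  · rw [abs_of_nonneg h]
    simp [if_pos h, mul_comm (g j)]
  · rw [abs_of_neg (not_le.1 h)]
    simp [if_neg h, mul_comm (g j)]

/-- A diagonal scaling adapted to `Θ` and to the unit ball of `γ`. -/
lemma exists_scaling {d : ℕ} {Θ : Set (E d)} (hortho : Orthosymmetric Θ)
    (hqc : QuadraticallyConvex Θ) (hcomp : IsCompact Θ) (γ : Seminorm ℝ (E d))
    (hγ : ∀ x, γ x = 0 → x = 0) {s : ℝ}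
    (hs : ∀ θ ∈ Θ, ∀ g ∈ qHull (normBall γ 0 1), inner ℝ θ g ≤ s) {ε : ℝ} (hε : 0 < ε) :
    ∃ c : Fin d → ℝ, (∀ j, 0 < c j) ∧ ∀ θ ∈ Θ, ∀ g : E d, γ g ≤ 1 →
      1 / 2 * ∑ j, (θ j ^ 2 / c j + c j * g j ^ 2) ≤ s + ε := by
  set Q := qHull (normBall γ 0 1)
  obtain ⟨hQ1, -, -, hQ4⟩ := (qHull_isLeast (normBall γ 0 1)).1
  obtain ⟨R, hR, hQR⟩ := exists_bound_qHull_normBall γ hγ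
  have hsq : Continuous fun θ : E d => (WithLp.toLp 2 (fun j => θ j ^ 2) : E d) := by fun_prop
  have hbdd : Bornology.IsBounded (squareSet Q) := by
    have hsub : Q ⊆ Metric.closedBall 0 (√(∑ _j : Fin d, R ^ 2)) := by
      intro g hg
      rw [mem_closedBall_zero_iff, EuclideanSpace.norm_eq]
      gcongr with j _
      exact hQR g hg j
    exact (((isCompact_closedBall (0 : E d) _).image hsq).isBounded).subset
      (Set.image_mono hsub)
  have hclosed0 : IsClosed {v : E d | ∀ j, 0 ≤ v j} := by
    simp only [Set.ofPred_forall]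
    exact isClosed_iInter fun j => isClosed_le continuous_const (by fun_prop)
  have hU0 : ∀ u ∈ squareSet Θ, ∀ j, 0 ≤ u j := by
    rintro _ ⟨θ, -, rfl⟩ j
    exact sq_nonneg _
  have hV0 : ∀ v ∈ closure (squareSet Q), ∀ j, 0 ≤ v j := by
    intro v hv
    refine closure_minimal (t := {v : E d | ∀ j, 0 ≤ v j}) ?_ hclosed0 hv
    rintro _ ⟨g, -, rfl⟩ j
    exact sq_nonneg _
  -- The squares of the hull are not known to form a closed set. Their closure is used for
  -- compactness, and the inequality passes to it by continuity.
  have hsum : ∀ u ∈ squareSet Θ, ∀ v ∈ closure (squareSet Q), ∑ j, √(u j * v j) ≤ s := by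
    intro u hu v hv
    refine closure_minimal (t := {v : E d | ∑ j, √(u j * v j) ≤ s}) ?_
      (isClosed_le (by fun_prop) continuous_const) hv
    rintro _ ⟨g, hg, rfl⟩
    obtain ⟨θ, hθ, rfl⟩ := hu
    refine le_trans (le_of_eq ?_) (sum_abs_mul_abs_le hortho (fun τ hτ => hs τ hτ g hg) hθ)
    refine Finset.sum_congr rfl fun j _ => ?_
    simp only [← mul_pow]
    rw [Real.sqrt_sq_eq_abs, abs_mul]
  obtain ⟨c, hc, hle⟩ := exists_scaling_of_sum_sqrt_le hqc hQ4.closure (hcomp.image hsq)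
    (hbdd.isCompact_closure) hU0 hV0 hsum hε
  refine ⟨c, hc, fun θ hθ g hg => ?_⟩
  exact hle _ ⟨θ, hθ, rfl⟩ _ (subset_closure ⟨g, hQ1 (by simpa [normBall] using hg), rfl⟩)

/-! ### The regret of diagonally scaled subgradient descent -/

lemma EReal_le_coe_of_forall_pos {x : EReal} {r : ℝ} (h : ∀ ε : ℝ, 0 < ε → x ≤ ((r + ε : ℝ) : EReal)) :
    x ≤ (r : EReal) := by
  refine (EReal.le_of_forall_lt_iff_le).1 fun z hz => ?_
  have hz' : r < z := EReal.coe_lt_coe_iff.1 hz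
  simpa using h (z - r) (by linarith)

/-- The iterates of online subgradient descent with coordinatewise step sizes `c`, started at `0`;
`sel (θ, x)` is the subgradient used at the point `θ` for the observation `x`. -/
def scaledDescent {d : ℕ} {𝒳 : Type u} (sel : E d × 𝒳 → E d) (c : Fin d → ℝ) :
    (m : ℕ) → (Fin m → 𝒳) → E d
  | 0, _ => 0
  | m + 1, x => scaledDescent sel c m (fun j => x j.castSucc) - WithLp.toLp 2 fun j =>
      c j * sel (scaledDescent sel c m (fun j => x j.castSucc), x (Fin.last m)) j

section ScaledDescent

variable {d : ℕ} {𝒳 : Type u} {sel : E d × 𝒳 → E d} {c : Fin d → ℝ}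

lemma measurable_scaledDescent [MeasurableSpace 𝒳] (hsel : Measurable sel) (m : ℕ) :
    Measurable (scaledDescent sel c m) := by
  induction m with
  | zero => exact measurable_const
  | succ m ih =>
    have h1 : Measurable fun x : Fin (m + 1) → 𝒳 =>
        scaledDescent sel c m (fun j => x j.castSucc) :=
      ih.comp (measurable_pi_lambda _ fun j => measurable_pi_apply _)
    have h2 : Measurable fun g : E d => (WithLp.toLp 2 fun j => c j * g j : E d) :=
      Continuous.measurable (by fun_prop)
    exact h1.sub (h2.comp (hsel.comp (h1.prodMk (measurable_pi_apply _))))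

/-- The potential is the squared distance to `θ` with weights `1 / c j`. Expanding it after one step
gives a cross term equal to twice the subgradient inner product, which pays for the loss difference,
and a remainder controlled by `b`. Keeping the final potential on the left makes the induction
close. -/
lemma sum_scaledDescent_add_le {F : E d → 𝒳 → ℝ} {θ : E d} {ε b : ℝ} (hc : ∀ j, 0 < c j)
    (hsub : ∀ τ x, F τ x + inner ℝ (sel (τ, x)) (θ - τ) ≤ F θ x + ε)
    (hb : ∀ p, 1 / 2 * ∑ j, c j * sel p j ^ 2 ≤ b) (n : ℕ) (x : Fin n → 𝒳) :
    ∑ i : Fin n, (F (scaledDescent sel c i fun j => x (Fin.castLE i.isLt.le j)) (x i) - F θ (x i))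
      + 1 / 2 * ∑ j, (scaledDescent sel c n x j - θ j) ^ 2 / c j
    ≤ 1 / 2 * ∑ j, θ j ^ 2 / c j + n * (ε + b) := by
  induction n with
  | zero => simp [scaledDescent]
  | succ n ih =>
    have hih := ih fun j => x j.castSucc
    rw [Fin.sum_univ_castSucc]
    change ∑ i : Fin n, (F (scaledDescent sel c i fun j => x (Fin.castSucc (Fin.castLE i.isLt.le j)))
      (x i.castSucc) - F θ (x i.castSucc))
      + (F (scaledDescent sel c n fun j => x j.castSucc) (x (Fin.last n)) - F θ (x (Fin.last n)))
      + 1 / 2 * ∑ j, ((scaledDescent sel c n (fun j => x j.castSucc) - WithLp.toLp 2 fun j =>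
        c j * sel (scaledDescent sel c n (fun j => x j.castSucc), x (Fin.last n)) j : E d) j - θ j) ^ 2
        / c j ≤ _
    set τ := scaledDescent sel c n fun j => x j.castSucc
    set g := sel (τ, x (Fin.last n)) with hg
    have h1 := hsub τ (x (Fin.last n))
    have h2 := hb (τ, x (Fin.last n))
    rw [← hg] at h1 h2
    have h3 : inner ℝ g (θ - τ) = ∑ j, g j * (θ j - τ j) := by
      rw [PiLp.inner_apply]
      exact Finset.sum_congr rfl fun j _ => by simp [mul_comm]
    have h4 : ∑ j, ((τ - WithLp.toLp 2 fun j => c j * g j : E d) j - θ j) ^ 2 / c j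
        = ∑ j, (τ j - θ j) ^ 2 / c j + 2 * ∑ j, g j * (θ j - τ j) + ∑ j, c j * g j ^ 2 := by
      rw [Finset.mul_sum, ← Finset.sum_add_distrib, ← Finset.sum_add_distrib]
      refine Finset.sum_congr rfl fun j _ => ?_
      have := (hc j).ne'
      simp only [PiLp.sub_apply]
      field_simp
      ring
    rw [h4]
    push_cast
    linarith

end ScaledDescent

/-- The minimax regret is at most `sup ⟨θ, g⟩ / √n` over `Θ` and the quadratic hull. -/
lemma minimaxRegretOf_le {d : ℕ} {n : ℕ} (hn : 1 ≤ n) {Θ : Set (E d)} (hne : Θ.Nonempty)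
    (hortho : Orthosymmetric Θ) (hqc : QuadraticallyConvex Θ) (hcomp : IsCompact Θ)
    {γ : Seminorm ℝ (E d)} (hγ : ∀ x, γ x = 0 → x = 0) (𝒳 : Type u) [MeasurableSpace 𝒳] {s : ℝ}
    (hs : ∀ θ ∈ Θ, ∀ g ∈ qHull (normBall γ 0 1), inner ℝ θ g ≤ s) :
    minimaxRegretOf n Θ (lossFamily γ 1 𝒳) ≤ ((1 / √n * s : ℝ) : EReal) := by
  classical
  have hn0 : (0 : ℝ) < n := by exact_mod_cast hn
  have hsq : 0 < √(n : ℝ) := Real.sqrt_pos.2 hn0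
  have hss : √(n : ℝ) * √(n : ℝ) = n := Real.mul_self_sqrt hn0.le
  refine EReal_le_coe_of_forall_pos fun ε' hε' => ?_
  -- `ε` is spent twice: once by the approximate subgradients, and once, divided by `√n`, by the
  -- approximate scaling.
  set ε := ε' / (1 / √n + 1) with hεdef
  have hε : 0 < ε := by positivity
  obtain ⟨c, hc, hcs⟩ := exists_scaling hortho hqc hcomp γ hγ hs hε
  have hsel : ∀ F ∈ lossFamily γ 1 𝒳, ∃ sel : E d × 𝒳 → E d, Measurable sel ∧
      (∀ p, γ (sel p) ≤ 1) ∧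
      ∀ θ x, ∀ τ ∈ Θ, F θ x + inner ℝ (sel (θ, x)) (τ - θ) ≤ F τ x + ε := fun F hF =>
    lossFamily.exists_measurable_approx_subgradient hF hne hcomp.isBounded hε
  choose! sel hmeas hball hsub using hsel
  refine iInf₂_le_of_le (fun F i => scaledDescent (sel F) (fun j => c j / √n) i)
    (fun F hF i => measurable_scaledDescent (hmeas F hF) _) ?_
  refine iSup₂_le fun F hF => iSup_le fun x => iSup₂_le fun θ hθ => ?_
  rw [EReal.coe_le_coe_iff]
  set A := 1 / 2 * ∑ j, θ j ^ 2 / c j with hA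
  -- The gradient bound depends on the comparator through `A`. In the total `√n * A + n * (s + ε -
  -- A) / √n` the term `A` cancels, so the final bound is uniform in `θ`.
  have hb : ∀ p, 1 / 2 * ∑ j, c j / √n * sel F p j ^ 2 ≤ (s + ε - A) / √n := by
    intro p
    have h := hcs θ hθ _ (hball F hF p)
    rw [Finset.sum_add_distrib] at h
    have e : ∑ j, c j / √n * sel F p j ^ 2 = (∑ j, c j * sel F p j ^ 2) / √n := by
      rw [Finset.sum_div]
      exact Finset.sum_congr rfl fun j _ => by ring
    rw [e, ← mul_div_assoc]
    gcongr
    linarith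
  have key := sum_scaledDescent_add_le (fun j => div_pos (hc j) hsq)
    (fun τ x => hsub F hF τ x θ hθ) hb n x
  have hA' : 1 / 2 * ∑ j, θ j ^ 2 / (c j / √n) = √n * A := by
    rw [hA, mul_left_comm, Finset.mul_sum (a := √(n : ℝ))]
    congr 1
    refine Finset.sum_congr rfl fun j _ => ?_
    have := (hc j).ne'
    field_simp
  have hnonneg : 0 ≤ 1 / 2 * ∑ j, (scaledDescent (sel F) (fun j => c j / √n) n x j - θ j) ^ 2
      / (c j / √n) := by
    have : ∀ j, 0 < c j / √n := fun j => div_pos (hc j) hsq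
    exact mul_nonneg (by norm_num) (Finset.sum_nonneg fun j _ => div_nonneg (sq_nonneg _) (this j).le)
  rw [hA'] at key
  have hfin : √n * A + n * (ε + (s + ε - A) / √n) = n * (1 / √n * s + ε') := by
    have h1 : ε' = ε * (1 / √n + 1) := by
      rw [hεdef, div_mul_cancel₀]
      positivity
    rw [h1]
    have h2 : √(n : ℝ) * A = n * (A / √n) := by
      rw [← mul_div_assoc, eq_div_iff hsq.ne', mul_right_comm, hss]
    rw [h2]
    ring
  rw [hfin] at key
  rw [one_div_mul_eq_div, div_le_iff₀ hn0, mul_comm (1 / √(n : ℝ) * s + ε') (n : ℝ)]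
  linarith

lemma zero_mem_lossFamily {d : ℕ} (γ : Seminorm ℝ (E d)) (𝒳 : Type u) [MeasurableSpace 𝒳] :
    (fun (_ : E d) (_ : 𝒳) => (0 : ℝ)) ∈ lossFamily γ 1 𝒳 := by
  refine ⟨fun _ => convexOn_const 0 convex_univ, fun _ => measurable_const, fun x θ g hg => ?_⟩
  have h := hg (θ + g)
  simp only [add_sub_cancel_left, real_inner_self_eq_norm_sq, zero_add] at h
  have : g = 0 := by
    rw [← norm_eq_zero]
    nlinarith [norm_nonneg g]
  simp [this]

/-! ### Regular behaviour of online algorithms after quantizing the observations -/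

section Quantize

variable {d : ℕ} {γ : Seminorm ℝ (E d)} {𝒳 : Type u} [MeasurableSpace 𝒳] {F : E d → 𝒳 → ℝ}

/-- Increments of the loss on a ball can be approximated uniformly by those at finitely many
observations, chosen measurably. -/
lemma lossFamily.exists_quantizer [Nonempty 𝒳] (hγ : ∀ x, γ x = 0 → x = 0)
    (hF : F ∈ lossFamily γ 1 𝒳) (R : ℝ) {ε : ℝ} (hε : 0 < ε) :
    ∃ q : 𝒳 → 𝒳, Measurable q ∧ (Set.range q).Finite ∧ ∀ x θ θ', ‖θ‖ ≤ R → ‖θ'‖ ≤ R →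
      |(F θ x - F θ' x) - (F θ (q x) - F θ' (q x))| ≤ ε := by
  obtain ⟨L, hL, hLip⟩ := lossFamily.exists_lipschitz hγ hF
  set η := ε / (2 * (2 * L + 1)) with hηdef
  have hη : 0 < η := by positivity
  obtain ⟨t, htR, htfin, htcov⟩ := (isCompact_closedBall (0 : E d) R).finite_cover_balls hη
  have := htfin.fintype
  -- The fingerprint of an observation: its loss increments at a finite `η`-net of the ball, rounded
  -- to multiples of `η`. By the Lipschitz bound there are finitely many fingerprints, and
  -- observations sharing one have close increments on the whole ball.
  let κ : 𝒳 → (t → ℤ) := fun x a => ⌊(F a x - F 0 x) / η⌋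
  have hκm : Measurable κ := measurable_pi_lambda _ fun a =>
    (((hF.2.1 a).sub (hF.2.1 0)).div_const η).floor
  have hκfin : (Set.range κ).Finite := by
    refine (Set.finite_Icc (fun _ => ⌊-(L * R) / η⌋ : t → ℤ) (fun _ => ⌊L * R / η⌋)).subset ?_
    rintro _ ⟨x, rfl⟩
    have hb : ∀ a : t, |F a x - F 0 x| ≤ L * R := fun a => by
      have h1 := hLip x a 0
      have h2 : ‖(a : E d)‖ ≤ R := by simpa using htR a.2
      rw [sub_zero] at h1
      exact h1.trans (mul_le_mul_of_nonneg_left h2 hL.le)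
    refine ⟨fun a => ?_, fun a => ?_⟩
    · exact Int.floor_le_floor (by gcongr; exact neg_le_of_abs_le (hb a))
    · exact Int.floor_le_floor (by gcongr; exact le_of_abs_le (hb a))
  have hκq : ∀ x, κ (Function.invFun κ (κ x)) = κ x := fun x => Function.invFun_eq ⟨x, rfl⟩
  -- Replace each observation by a fixed representative of its fingerprint. The choice of
  -- representatives is measurable because fingerprints lie in a countable space.
  refine ⟨Function.invFun κ ∘ κ, (measurable_of_countable _).comp hκm, ?_, ?_⟩
  · rw [Set.range_comp]
    exact hκfin.image _
  · have key : ∀ x θ, ‖θ‖ ≤ R → |(F θ x - F 0 x) -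
        (F θ (Function.invFun κ (κ x)) - F 0 (Function.invFun κ (κ x)))| ≤ (2 * L + 1) * η := by
      intro x θ hθ
      set y := Function.invFun κ (κ x) with hy
      obtain ⟨a, ha, hθa⟩ : ∃ a ∈ t, θ ∈ Metric.ball a η := by
        simpa using htcov (show θ ∈ Metric.closedBall (0 : E d) R by simpa using hθ)
      have hd : ‖θ - a‖ ≤ η := by
        rw [← dist_eq_norm]
        exact (Metric.mem_ball.1 hθa).le
      have h1 := (hLip x θ a).trans (mul_le_mul_of_nonneg_left hd hL.le)
      have h2 := (hLip y θ a).trans (mul_le_mul_of_nonneg_left hd hL.le)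
      have h3 : |(F a x - F 0 x) / η - (F a y - F 0 y) / η| < 1 :=
        Int.abs_sub_lt_one_of_floor_eq_floor (congrFun (hκq x) ⟨a, ha⟩).symm
      rw [← sub_div, abs_div, abs_of_pos hη, div_lt_one hη] at h3
      rw [abs_le] at h1 h2 ⊢
      rw [abs_lt] at h3
      constructor <;> linarith [h1.1, h1.2, h2.1, h2.2, h3.1, h3.2]
    intro x θ θ' hθ hθ'
    have h1 := key x θ hθ
    have h2 := key x θ' hθ'
    have h3 : ε = 2 * ((2 * L + 1) * η) := by
      rw [hηdef]
      field_simp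
    simp only [Function.comp_apply]
    rw [abs_le] at h1 h2 ⊢
    constructor <;> linarith [h1.1, h1.2, h2.1, h2.2]

/-- Quantizing the observations makes the decisions of an online algorithm take finitely many
values while changing each loss difference by at most `ε`. -/
lemma lossFamily.exists_quantizers [Nonempty 𝒳] (hγ : ∀ x, γ x = 0 → x = 0)
    (hF : F ∈ lossFamily γ 1 𝒳) {n : ℕ} (alg : (i : Fin n) → (Fin i → 𝒳) → E d) (R : ℝ) {ε : ℝ}
    (hε : 0 < ε) :
    ∃ q : Fin n → 𝒳 → 𝒳, (∀ i, Measurable (q i) ∧ (Set.range (q i)).Finite) ∧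
      ∀ (i : Fin n) (x : Fin n → 𝒳) (θ : E d), ‖θ‖ ≤ R →
        |(F (alg i fun j => q (Fin.castLE i.isLt.le j) (x (Fin.castLE i.isLt.le j))) (x i)
            - F θ (x i))
          - (F (alg i fun j => q (Fin.castLE i.isLt.le j) (x (Fin.castLE i.isLt.le j))) (q i (x i))
            - F θ (q i (x i)))| ≤ ε := by
  classical
  -- The quantizers are built one round at a time: that of round `i` must be accurate on a ball
  -- containing the `i`-th decisions, and these form a finite set only once all earlier rounds have
  -- been quantized.
  suffices h : ∀ m : ℕ, ∃ q : Fin n → 𝒳 → 𝒳, (∀ i, Measurable (q i) ∧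
      (i.1 < m → (Set.range (q i)).Finite)) ∧
      ∀ (i : Fin n), i.1 < m → ∀ (x : Fin n → 𝒳) (θ : E d), ‖θ‖ ≤ R →
        |(F (alg i fun j => q (Fin.castLE i.isLt.le j) (x (Fin.castLE i.isLt.le j))) (x i)
            - F θ (x i))
          - (F (alg i fun j => q (Fin.castLE i.isLt.le j) (x (Fin.castLE i.isLt.le j))) (q i (x i))
            - F θ (q i (x i)))| ≤ ε by
    obtain ⟨q, hq1, hq2⟩ := h n
    exact ⟨q, fun i => ⟨(hq1 i).1, (hq1 i).2 i.isLt⟩, fun i => hq2 i i.isLt⟩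
  intro m
  induction m with
  | zero => exact ⟨fun _ => id, fun i => ⟨measurable_id, fun h => absurd h (by simp)⟩,
      fun i h => absurd h (by simp)⟩
  | succ m ih =>
    obtain ⟨q, hq1, hq2⟩ := ih
    by_cases hm : m < n
    swap
    · exact ⟨q, fun i => ⟨(hq1 i).1, fun h => (hq1 i).2 (by omega)⟩, fun i h => hq2 i (by omega)⟩
    let i₀ : Fin n := ⟨m, hm⟩
    have hfin : (Set.range fun x : Fin n → 𝒳 =>
        alg i₀ fun j => q (Fin.castLE i₀.isLt.le j) (x (Fin.castLE i₀.isLt.le j))).Finite := by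
      have h1 : (Set.univ.pi fun j : Fin i₀ => Set.range (q (Fin.castLE i₀.isLt.le j))).Finite :=
        Set.Finite.pi fun j => (hq1 _).2 j.isLt
      refine (h1.image (alg i₀)).subset ?_
      rintro _ ⟨x, rfl⟩
      exact ⟨_, fun j _ => ⟨_, rfl⟩, rfl⟩
    obtain ⟨R₀, hR₀⟩ := hfin.isBounded.exists_norm_le
    obtain ⟨q', hq'm, hq'f, hq'⟩ := lossFamily.exists_quantizer hγ hF (max R R₀) hε
    have hne : ∀ (i : Fin n), i.1 < m + 1 → ∀ j : Fin i,
        Function.update q i₀ q' (Fin.castLE i.isLt.le j) = q (Fin.castLE i.isLt.le j) := by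
      intro i hi j
      refine Function.update_of_ne (fun h => ?_) _ _
      have h1 : j.1 = m := congrArg Fin.val h
      have := j.isLt
      omega
    refine ⟨Function.update q i₀ q', fun i => ?_, fun i hi x θ hθ => ?_⟩
    · by_cases h : i = i₀
      · subst h
        rw [Function.update_self]
        exact ⟨hq'm, fun _ => hq'f⟩
      · rw [Function.update_of_ne h]
        refine ⟨(hq1 i).1, fun hi => (hq1 i).2 ?_⟩
        have : i.1 ≠ m := fun h' => h (Fin.ext h')
        omega
    · simp only [hne i hi]
      by_cases h : i = i₀
      · subst h
        rw [Function.update_self]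
        exact hq' _ _ _ ((hR₀ _ ⟨x, rfl⟩).trans (le_max_right _ _)) (hθ.trans (le_max_left _ _))
      · rw [Function.update_of_ne h]
        have : i.1 ≠ m := fun h' => h (Fin.ext h')
        exact hq2 i (by omega) x θ hθ

/-- An online algorithm with bounded regret for the loss `F` can be replaced by one with bounded
decisions and almost the same regret. -/
lemma lossFamily.exists_bounded_algorithm [Nonempty 𝒳] (hγ : ∀ x, γ x = 0 → x = 0)
    (hF : F ∈ lossFamily γ 1 𝒳) {n : ℕ} {Θ : Set (E d)}
    (hΘ : Bornology.IsBounded Θ) {alg : (i : Fin n) → (Fin i → 𝒳) → E d}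
    (hmeas : ∀ i, Measurable (alg i)) {r : ℝ}
    (hr : ∀ (x : Fin n → 𝒳), ∀ θ ∈ Θ, 1 / (n : ℝ) * ∑ i : Fin n,
      (F (alg i fun j => x (Fin.castLE i.isLt.le j)) (x i) - F θ (x i)) ≤ r)
    {ε : ℝ} (hε : 0 < ε) :
    ∃ alg' : (i : Fin n) → (Fin i → 𝒳) → E d, (∀ i, Measurable (alg' i)) ∧
      (∃ R, ∀ i y, ‖alg' i y‖ ≤ R) ∧
      ∀ (x : Fin n → 𝒳), ∀ θ ∈ Θ, 1 / (n : ℝ) * ∑ i : Fin n,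
        (F (alg' i fun j => x (Fin.castLE i.isLt.le j)) (x i) - F θ (x i)) ≤ r + ε := by
  obtain ⟨R, hR⟩ := hΘ.exists_norm_le
  obtain ⟨q, hq1, hq2⟩ := lossFamily.exists_quantizers hγ hF alg R hε
  refine ⟨fun i y => alg i fun j => q (Fin.castLE i.isLt.le j) (y j), fun i => ?_, ?_, ?_⟩
  · exact (hmeas i).comp (measurable_pi_lambda _ fun j =>
      (hq1 _).1.comp (measurable_pi_apply j))
  · have hfin : (⋃ i : Fin n, Set.range fun y : Fin i → 𝒳 =>
        alg i fun j => q (Fin.castLE i.isLt.le j) (y j)).Finite := by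
      refine Set.finite_iUnion fun i => ?_
      have h1 : (Set.univ.pi fun j : Fin i => Set.range (q (Fin.castLE i.isLt.le j))).Finite :=
        Set.Finite.pi fun j => (hq1 _).2
      refine (h1.image (alg i)).subset ?_
      rintro _ ⟨x, rfl⟩
      exact ⟨_, fun j _ => ⟨_, rfl⟩, rfl⟩
    obtain ⟨R', hR'⟩ := hfin.isBounded.exists_norm_le
    exact ⟨R', fun i y => hR' _ (Set.mem_iUnion.2 ⟨i, y, rfl⟩)⟩
  · intro x θ hθ
    have h1 := hr (fun i => q i (x i)) θ hθ
    have h2 : ∀ i ∈ (Finset.univ : Finset (Fin n)),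
        F (alg i fun j => q (Fin.castLE i.isLt.le j) (x (Fin.castLE i.isLt.le j))) (x i) - F θ (x i)
        ≤ (F (alg i fun j => q (Fin.castLE i.isLt.le j) (x (Fin.castLE i.isLt.le j))) (q i (x i))
          - F θ (q i (x i))) + ε := by
      intro i _
      have := le_of_abs_le (hq2 i x θ (hR θ hθ))
      linarith
    have h3 := Finset.sum_le_sum h2
    rw [Finset.sum_add_distrib, Finset.sum_const, Finset.card_univ, Fintype.card_fin,
      nsmul_eq_mul] at h3
    have h4 := mul_le_mul_of_nonneg_left h3 (by positivity : (0 : ℝ) ≤ 1 / n)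
    rw [mul_add] at h4
    have h5 : 1 / (n : ℝ) * (n * ε) ≤ ε := by
      rcases Nat.eq_zero_or_pos n with h | h
      · simp [h, hε.le]
      · have : (n : ℝ) ≠ 0 := by exact_mod_cast h.ne'
        rw [← mul_assoc, one_div_mul_cancel this, one_mul]
    linarith

end Quantize

/-! ### Online-to-batch conversion -/

lemma extExpectation_eq_integral {Ω : Type u} [MeasurableSpace Ω] {μ : Measure Ω} {f : Ω → ℝ}
    (hf : Integrable f μ) : extExpectation μ f = ((∫ ω, f ω ∂μ : ℝ) : EReal) := by
  have h1 : ∫⁻ ω, ENNReal.ofReal (f ω) ∂μ ≠ ⊤ := hf.lintegral_lt_top.ne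
  have h2 : ∫⁻ ω, ENNReal.ofReal (-f ω) ∂μ ≠ ⊤ := hf.neg.lintegral_lt_top.ne
  rw [extExpectation, if_neg h1, integral_eq_lintegral_pos_part_sub_lintegral_neg_part hf,
    EReal.coe_sub, EReal.coe_ennreal_toReal h1, EReal.coe_ennreal_toReal h2]

section Batch

variable {d : ℕ} {γ : Seminorm ℝ (E d)} {𝒳 : Type u} [MeasurableSpace 𝒳] {F : E d → 𝒳 → ℝ}
  {P : ProbabilityMeasure 𝒳}

lemma convexOn_expectedLoss (hF : F ∈ lossFamily γ 1 𝒳)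
    (hP : ∀ θ, Integrable (F θ) (P : Measure 𝒳)) : ConvexOn ℝ Set.univ (expectedLoss F P) := by
  refine ⟨convex_univ, fun θ _ τ _ a b ha hb hab => ?_⟩
  simp only [expectedLoss, smul_eq_mul]
  rw [← integral_const_mul, ← integral_const_mul,
    ← integral_add ((hP θ).const_mul a) ((hP τ).const_mul b)]
  exact integral_mono (hP _) (((hP θ).const_mul a).add ((hP τ).const_mul b)) fun x =>
    (hF.1 x).2 trivial trivial ha hb hab

lemma abs_expectedLoss_sub_le {L : ℝ} (hL : ∀ x θ θ', |F θ x - F θ' x| ≤ L * ‖θ - θ'‖)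
    (hP : ∀ θ, Integrable (F θ) (P : Measure 𝒳)) (θ θ' : E d) :
    |expectedLoss F P θ - expectedLoss F P θ'| ≤ L * ‖θ - θ'‖ := by
  rw [expectedLoss, expectedLoss, ← integral_sub (hP θ) (hP θ'), ← Real.norm_eq_abs]
  simpa using norm_integral_le_of_norm_le_const (μ := (P : Measure 𝒳))
    (f := fun x => F θ x - F θ' x) (C := L * ‖θ - θ'‖) (Filter.Eventually.of_forall fun x => hL x θ θ')

/-- The expected loss at the next observation of a decision based on the previous ones. -/
lemma integral_loss_prefix {m : ℕ} (i : Fin (m + 1)) {τ : (Fin i → 𝒳) → E d}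
    (hint : Integrable (fun X : Fin (m + 1) → 𝒳 =>
      F (τ fun j => X (Fin.castLE i.isLt.le j)) (X i)) (Measure.pi fun _ => (P : Measure 𝒳))) :
    ∫ X : Fin (m + 1) → 𝒳, F (τ fun j => X (Fin.castLE i.isLt.le j)) (X i)
        ∂(Measure.pi fun _ => (P : Measure 𝒳))
      = ∫ X : Fin (m + 1) → 𝒳, expectedLoss F P (τ fun j => X (Fin.castLE i.isLt.le j))
        ∂(Measure.pi fun _ => (P : Measure 𝒳)) := by
  set μ : Measure 𝒳 := (P : Measure 𝒳)
  -- Splitting off coordinate `i` leaves a product measure in which the earlier observations depend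
  -- only on the second factor; Fubini then integrates out `X i` first.
  have hpres := measurePreserving_piFinSuccAbove (fun _ : Fin (m + 1) => μ) i
  set e := MeasurableEquiv.piFinSuccAbove (fun _ : Fin (m + 1) => 𝒳) i
  have hi : ∀ j : Fin i, j.1 < m := fun j => by
    have := j.isLt
    have := i.isLt
    omega
  let pre : (Fin m → 𝒳) → (Fin i → 𝒳) := fun y j => y ⟨j, hi j⟩
  have he1 : ∀ X, (e X).1 = X i := fun X => rfl
  have he2 : ∀ X : Fin (m + 1) → 𝒳, pre (e X).2 = fun j => X (Fin.castLE i.isLt.le j) := by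
    intro X
    funext j
    change X (i.succAbove ⟨j, hi j⟩) = _
    rw [Fin.succAbove_of_castSucc_lt _ _ (by exact j.isLt)]
    rfl
  have h1 : (fun X : Fin (m + 1) → 𝒳 => F (τ fun j => X (Fin.castLE i.isLt.le j)) (X i))
      = (fun p : 𝒳 × (Fin m → 𝒳) => F (τ (pre p.2)) p.1) ∘ e := by
    funext X
    simp only [Function.comp_apply, he1, he2]
  have h2 : (fun X : Fin (m + 1) → 𝒳 => expectedLoss F P (τ fun j => X (Fin.castLE i.isLt.le j)))
      = (fun p : 𝒳 × (Fin m → 𝒳) => expectedLoss F P (τ (pre p.2))) ∘ e := by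
    funext X
    simp only [Function.comp_apply, he2]
  rw [h1] at hint ⊢
  rw [h2]
  have hint' := (hpres.integrable_comp_emb e.measurableEmbedding).1 hint
  have e1 := hpres.integral_comp' (fun p : 𝒳 × (Fin m → 𝒳) => F (τ (pre p.2)) p.1)
  have e2 := hpres.integral_comp' (fun p : 𝒳 × (Fin m → 𝒳) => expectedLoss F P (τ (pre p.2)))
  simp only [Function.comp_def]
  refine e1.trans (Eq.trans ?_ e2.symm)
  rw [integral_prod_symm _ hint']
  exact (integral_fun_snd (μ := μ) (ν := Measure.pi fun _ : Fin m => μ)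
    (fun y => expectedLoss F P (τ (pre y)))).symm ▸ by simp [expectedLoss, μ]

/-- Averaging the decisions of an online algorithm with bounded decisions gives a procedure whose
excess risk is bounded by the regret. -/
lemma extExpectation_average_le (hγ : ∀ x, γ x = 0 → x = 0) (hF : F ∈ lossFamily γ 1 𝒳)
    (hP : ∀ θ, Integrable (F θ) (P : Measure 𝒳)) {n : ℕ} (hn : 1 ≤ n) {Θ : Set (E d)}
    (hne : Θ.Nonempty) {alg : (i : Fin n) → (Fin i → 𝒳) → E d}
    (hmeas : ∀ i, Measurable (alg i)) {R : ℝ} (hR : ∀ i y, ‖alg i y‖ ≤ R) {r : ℝ}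
    (hr : ∀ (x : Fin n → 𝒳), ∀ θ ∈ Θ, 1 / (n : ℝ) * ∑ i : Fin n,
      (F (alg i fun j => x (Fin.castLE i.isLt.le j)) (x i) - F θ (x i)) ≤ r) :
    extExpectation (Measure.pi fun _ : Fin n => (P : Measure 𝒳)) (fun X =>
      expectedLoss F P ((1 / (n : ℝ)) • ∑ i : Fin n, alg i fun j => X (Fin.castLE i.isLt.le j))
        - ⨅ θ : Θ, expectedLoss F P θ) ≤ (r : EReal) := by
  obtain ⟨L, hL, hLip⟩ := lossFamily.exists_lipschitz hγ hF
  have hn0 : (0 : ℝ) < n := by exact_mod_cast hn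
  set μ : Measure 𝒳 := (P : Measure 𝒳)
  set f := expectedLoss F P with hf
  have hfconv : ConvexOn ℝ Set.univ f := convexOn_expectedLoss hF hP
  have hfm : Measurable f := (continuous_of_convexOn_univ hfconv).measurable
  have hfL := abs_expectedLoss_sub_le hLip hP
  let τ : (i : Fin n) → (Fin n → 𝒳) → E d := fun i X => alg i fun j => X (Fin.castLE i.isLt.le j)
  have hτm : ∀ i, Measurable (τ i) := fun i =>
    (hmeas i).comp (measurable_pi_lambda _ fun j => measurable_pi_apply _)
  have hτR : ∀ i X, ‖τ i X‖ ≤ R := fun i X => hR _ _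
  have hfb : ∀ (T : (Fin n → 𝒳) → E d), Measurable T → ∀ C, (∀ X, ‖T X‖ ≤ C) →
      Integrable (fun X => f (T X)) (Measure.pi fun _ : Fin n => μ) := by
    intro T hT C hC
    refine Integrable.of_bound (hfm.comp hT).aestronglyMeasurable (L * C + |f 0|)
      (Filter.Eventually.of_forall fun X => ?_)
    have h1 := hfL (T X) 0
    rw [sub_zero] at h1
    have h2 := mul_le_mul_of_nonneg_left (hC X) hL.le
    have h3 := abs_sub_abs_le_abs_sub (f (T X)) (f 0)
    rw [Real.norm_eq_abs]
    linarith
  have hFτ : ∀ i, Integrable (fun X => F (τ i X) (X i)) (Measure.pi fun _ : Fin n => μ) := by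
    intro i
    have h0 : Integrable (fun X : Fin n → 𝒳 => F 0 (X i)) (Measure.pi fun _ : Fin n => μ) :=
      (measurePreserving_eval (fun _ : Fin n => μ) i).integrable_comp_of_integrable (hP 0)
    have hm : Measurable fun X : Fin n → 𝒳 => F (τ i X) (X i) :=
      (lossFamily.measurable_uncurry hF).comp ((hτm i).prodMk (measurable_pi_apply i))
    -- Boundedness of the decisions enters here: the loss differs from the integrable `F 0` by a
    -- bounded function.
    have h1 : Integrable (fun X => F (τ i X) (X i) - F 0 (X i)) (Measure.pi fun _ : Fin n => μ) := by
      refine Integrable.of_bound (hm.sub ((hF.2.1 0).comp (measurable_pi_apply i))).aestronglyMeasurable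
        (L * R) (Filter.Eventually.of_forall fun X => ?_)
      have h2 := hLip (X i) (τ i X) 0
      rw [sub_zero] at h2
      exact h2.trans (mul_le_mul_of_nonneg_left (hτR i X) hL.le)
    refine (h1.add h0).congr (Filter.Eventually.of_forall fun X => ?_)
    simp
  let avg : (Fin n → 𝒳) → E d := fun X => (1 / (n : ℝ)) • ∑ i, τ i X
  have havgm : Measurable avg :=
    (Finset.measurable_fun_sum _ fun i _ => hτm i).const_smul (1 / (n : ℝ))
  have havgR : ∀ X, ‖avg X‖ ≤ R := by
    intro X
    have h1 : ‖∑ i, τ i X‖ ≤ n * R := by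
      simpa using norm_sum_le_of_le Finset.univ fun i _ => hτR i X
    rw [norm_smul, Real.norm_of_nonneg (by positivity), one_div_mul_eq_div, div_le_iff₀ hn0]
    linarith
  have hIavg := hfb avg havgm R havgR
  have hjensen : ∀ X, f (avg X) ≤ 1 / (n : ℝ) * ∑ i, f (τ i X) := by
    intro X
    have h := hfconv.map_sum_le (t := Finset.univ) (w := fun _ : Fin n => 1 / (n : ℝ))
      (p := fun i => τ i X) (fun _ _ => by positivity) (by simp [hn0.ne']) (fun _ _ => trivial)
    simpa [avg, Finset.smul_sum, Finset.mul_sum] using h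
  have hswap : ∀ i, ∫ X, F (τ i X) (X i) ∂(Measure.pi fun _ : Fin n => μ)
      = ∫ X, f (τ i X) ∂(Measure.pi fun _ : Fin n => μ) := by
    obtain ⟨m, rfl⟩ : ∃ m, n = m + 1 := ⟨n - 1, by omega⟩
    intro i
    exact integral_loss_prefix i (hFτ i)
  -- The left side does not involve `θ`, so the bound for each fixed comparator passes to the
  -- infimum.
  have hmain : ∀ θ ∈ Θ, ∫ X, f (avg X) ∂(Measure.pi fun _ : Fin n => μ) - r ≤ f θ := by
    intro θ hθ
    have hFθ : ∀ i : Fin n, Integrable (fun X : Fin n → 𝒳 => F θ (X i))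
        (Measure.pi fun _ : Fin n => μ) := fun i =>
      (measurePreserving_eval (fun _ : Fin n => μ) i).integrable_comp_of_integrable (hP θ)
    have hFθv : ∀ i : Fin n, ∫ X : Fin n → 𝒳, F θ (X i) ∂(Measure.pi fun _ : Fin n => μ) = f θ :=
      fun i => integral_comp_eval (μ := fun _ : Fin n => μ) (i := i) (hP θ).aestronglyMeasurable
    have h1 : ∫ X, f (avg X) ∂(Measure.pi fun _ : Fin n => μ)
        ≤ 1 / (n : ℝ) * ∑ i, ∫ X, f (τ i X) ∂(Measure.pi fun _ : Fin n => μ) := by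
      rw [← integral_finsetSum _ fun i _ => hfb _ (hτm i) R (hτR i), ← integral_const_mul]
      exact integral_mono hIavg
        ((integrable_finsetSum _ fun i _ => hfb _ (hτm i) R (hτR i)).const_mul _) hjensen
    have h2 : 1 / (n : ℝ) * ∑ i, (∫ X, F (τ i X) (X i) ∂(Measure.pi fun _ : Fin n => μ) - f θ) ≤ r := by
      have e : 1 / (n : ℝ) * ∑ i, (∫ X, F (τ i X) (X i) ∂(Measure.pi fun _ : Fin n => μ) - f θ)
          = ∫ X : Fin n → 𝒳, 1 / (n : ℝ) * ∑ i, (F (τ i X) (X i) - F θ (X i))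
            ∂(Measure.pi fun _ : Fin n => μ) := by
        rw [integral_const_mul]
        congr 1
        refine Eq.trans ?_ (integral_finsetSum _ fun i _ => (hFτ i).sub (hFθ i)).symm
        refine Finset.sum_congr rfl fun i _ => ?_
        rw [integral_sub' (hFτ i) (hFθ i), hFθv i]
      rw [e]
      calc _ ≤ ∫ _X : Fin n → 𝒳, r ∂(Measure.pi fun _ : Fin n => μ) :=
            integral_mono ((integrable_finsetSum _ fun i _ => (hFτ i).sub (hFθ i)).const_mul _)
              (integrable_const r) fun X => hr X θ hθ
        _ = r := by simp
    simp only [hswap, Finset.sum_sub_distrib, Finset.sum_const, Finset.card_univ, Fintype.card_fin,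
      nsmul_eq_mul, mul_sub] at h2
    rw [← mul_assoc, one_div_mul_cancel hn0.ne', one_mul] at h2
    linarith
  have hinf : ∫ X, f (avg X) ∂(Measure.pi fun _ : Fin n => μ) - r ≤ ⨅ θ : Θ, f θ := by
    have := hne.to_subtype
    exact le_ciInf fun θ => hmain θ θ.2
  refine (extExpectation_eq_integral (hIavg.sub (integrable_const (⨅ θ : Θ, f θ)))).trans_le ?_
  rw [EReal.coe_le_coe_iff, integral_sub' hIavg (integrable_const _)]
  simp only [integral_const, probReal_univ, smul_eq_mul, one_mul]
  linarith

end Batch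

/-- The minimax stochastic risk is at most the minimax regret. -/
lemma minimaxRiskOf_le_minimaxRegretOf {d : ℕ} {n : ℕ} (hn : 1 ≤ n) {Θ : Set (E d)}
    (hne : Θ.Nonempty) (hΘ : Bornology.IsBounded Θ) {γ : Seminorm ℝ (E d)}
    (hγ : ∀ x, γ x = 0 → x = 0) {𝒳 : Type u} [MeasurableSpace 𝒳]
    (Ps : Set (ProbabilityMeasure 𝒳)) :
    minimaxRiskOf n Θ (lossFamily γ 1 𝒳) Ps ≤ minimaxRegretOf n Θ (lossFamily γ 1 𝒳) := by
  classical
  rcases isEmpty_or_nonempty 𝒳 with hX | hX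
  -- An empty space carries no probability measure, so the supremum in the risk is empty and equals
  -- `⊥`.
  · refine iInf₂_le_of_le (fun _ _ => 0) (fun _ _ => measurable_const) ?_
    refine iSup₂_le fun F _ => iSup₂_le fun P _ => ?_
    exact absurd P.nonempty (by simpa using hX)
  refine le_iInf₂ fun alg hmeas => ?_
  set ρ := ⨆ F ∈ lossFamily γ 1 𝒳, ⨆ x : Fin n → 𝒳, ⨆ θ ∈ Θ,
      (((1 / (n : ℝ)) * ∑ i : Fin n,
        (F (alg F i fun j => x (Fin.castLE i.isLt.le j)) (x i) - F θ (x i)) : ℝ) : EReal) with hρ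
  have hle : ∀ F ∈ lossFamily γ 1 𝒳, ∀ x : Fin n → 𝒳, ∀ θ ∈ Θ, (((1 / (n : ℝ)) * ∑ i : Fin n,
      (F (alg F i fun j => x (Fin.castLE i.isLt.le j)) (x i) - F θ (x i)) : ℝ) : EReal) ≤ ρ :=
    fun F hF x θ hθ => le_iSup₂_of_le F hF (le_iSup_of_le x (le_iSup₂_of_le θ hθ le_rfl))
  have hbot : ρ ≠ ⊥ := by
    obtain ⟨θ, hθ⟩ := hne
    obtain ⟨x⟩ := hX
    intro h
    have := hle _ (zero_mem_lossFamily γ 𝒳) (fun _ => x) θ hθ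
    rw [h, le_bot_iff] at this
    exact EReal.coe_ne_bot _ this
  induction hr : ρ using EReal.rec with
  | bot => exact absurd hr hbot
  | top => exact le_top
  | coe r =>
    refine EReal_le_coe_of_forall_pos fun ε hε => ?_
    -- The bound on the decisions may depend on `F`, which is harmless since procedures know the
    -- loss.
    have hex : ∀ F ∈ lossFamily γ 1 𝒳, ∃ alg' : (i : Fin n) → (Fin i → 𝒳) → E d,
        (∀ i, Measurable (alg' i)) ∧ (∃ R, ∀ i y, ‖alg' i y‖ ≤ R) ∧
        ∀ (x : Fin n → 𝒳), ∀ θ ∈ Θ, 1 / (n : ℝ) * ∑ i : Fin n,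
          (F (alg' i fun j => x (Fin.castLE i.isLt.le j)) (x i) - F θ (x i)) ≤ r + ε := by
      intro F hF
      refine lossFamily.exists_bounded_algorithm hγ hF hΘ (hmeas F hF) (fun x θ hθ => ?_) hε
      have := hle F hF x θ hθ
      rw [hr] at this
      exact EReal.coe_le_coe_iff.1 this
    choose! alg' hm' hR' hr' using hex
    refine iInf₂_le_of_le
      (fun F X => (1 / (n : ℝ)) • ∑ i : Fin n, alg' F i fun j => X (Fin.castLE i.isLt.le j))
      (fun F hF => ?_) ?_
    · exact (Finset.measurable_fun_sum _ fun i _ => (hm' F hF i).comp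
        (measurable_pi_lambda _ fun j => measurable_pi_apply _)).const_smul (1 / (n : ℝ))
    · refine iSup₂_le fun F hF => iSup₂_le fun P _ => iSup_le fun hP => ?_
      obtain ⟨R, hR⟩ := hR' F hF
      exact extExpectation_average_le hγ hF hP hn hne (hm' F hF) hR (hr' F hF)

/-! ### Testing between product measures -/

/-- With `t = n * a ≤ 0.23`, the powers are at most `exp t` and, by Bernoulli, at least `1 - t`. A
cubic Taylor bound for `exp t` then suffices. -/
lemma two_mul_pow_sub_pow_le {a : ℝ} {n : ℕ} (hn : 1 ≤ n) (ha : 0 ≤ a)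
    (hna : n * a ≤ 1 / (4 * Real.log 3)) : 2 * (1 + a) ^ n - 2 * (1 - a) ^ n ≤ 1 := by
  set t := n * a with ht
  have hn1 : (1 : ℝ) ≤ n := by exact_mod_cast hn
  have hlog : (1.09 : ℝ) ≤ Real.log 3 := by
    have := Real.log_three_gt_d9
    linarith
  have ht1 : t ≤ 0.23 := by
    refine hna.trans ?_
    rw [div_le_iff₀ (by linarith)]
    linarith
  have ht0 : 0 ≤ t := by positivity
  have hat : a ≤ t := by nlinarith
  have h1 : (1 + a) ^ n ≤ Real.exp t := by
    rw [ht, Real.exp_nat_mul]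
    have := Real.add_one_le_exp a
    exact pow_le_pow_left₀ (by linarith) (by linarith) n
  have h2 : 1 - t ≤ (1 - a) ^ n := by
    have := one_add_mul_le_pow (a := -a) (by linarith) n
    rw [← sub_eq_add_neg] at this
    linarith
  have h3 := Real.exp_bound' ht0 (by linarith) (n := 3) (by norm_num)
  norm_num [Finset.sum_range_succ, Nat.factorial] at h3
  have h4 : t ^ 2 ≤ 0.23 * t := by nlinarith
  have h5 : t ^ 3 ≤ 0.23 ^ 2 * t := by nlinarith
  norm_num at h4 h5
  linarith

/-- The `L¹` distance between the `n`-fold products of the densities `Q (1 + h)` and `Q (1 - h)`. -/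
lemma sum_abs_prod_sub_prod_le {Z : Type*} [Fintype Z] {Q h : Z → ℝ} (hQ : ∀ z, 0 ≤ Q z)
    (hQ1 : ∑ z, Q z = 1) (hQh : ∑ z, Q z * h z = 0) {n : ℕ} (hn : 1 ≤ n)
    (hvar : n * ∑ z, Q z * h z ^ 2 ≤ 1 / (4 * Real.log 3)) :
    ∑ X : Fin n → Z, |∏ i, Q (X i) * (1 + h (X i)) - ∏ i, Q (X i) * (1 - h (X i))| ≤ 1 := by
  set a := ∑ z, Q z * h z ^ 2 with ha
  have ha0 : 0 ≤ a := Finset.sum_nonneg fun z _ => mul_nonneg (hQ z) (sq_nonneg _)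
  have hpow : ∀ g : Z → ℝ, ∑ X : Fin n → Z, ∏ i, g (X i) = (∑ z, g z) ^ n := fun g =>
    (Fintype.sum_pow g n).symm
  have hprod : ∀ X : Fin n → Z, 0 ≤ ∏ i, Q (X i) := fun X => Finset.prod_nonneg fun i _ => hQ _
  set D : (Fin n → Z) → ℝ := fun X => ∏ i, (1 + h (X i)) - ∏ i, (1 - h (X i)) with hD
  -- Cauchy-Schwarz against the product of the `Q`'s reduces the `L¹` distance to a second moment,
  -- whose three terms factor over the sample.
  have hcs := Finset.sum_sq_le_sum_mul_sum_of_sq_le_mul Finset.univ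
    (r := fun X : Fin n → Z => (∏ i, Q (X i)) * |D X|) (f := fun X => ∏ i, Q (X i))
    (g := fun X => (∏ i, Q (X i)) * D X ^ 2) (fun X _ => hprod X)
    (fun X _ => mul_nonneg (hprod X) (sq_nonneg _))
    (fun X _ => le_of_eq (by rw [mul_pow, sq_abs]; ring))
  have hsq : ∑ X : Fin n → Z, (∏ i, Q (X i)) * D X ^ 2 = 2 * (1 + a) ^ n - 2 * (1 - a) ^ n := by
    have e1 : ∀ X : Fin n → Z, (∏ i, Q (X i)) * D X ^ 2
        = ∏ i, Q (X i) * (1 + h (X i)) ^ 2 + ∏ i, Q (X i) * (1 - h (X i)) ^ 2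
          - 2 * ∏ i, Q (X i) * (1 - h (X i) ^ 2) := by
      intro X
      have e : ∀ z, 1 - h z ^ 2 = (1 + h z) * (1 - h z) := fun z => by ring
      simp only [hD, e, Finset.prod_mul_distrib, Finset.prod_pow]
      ring
    simp only [e1, Finset.sum_sub_distrib, Finset.sum_add_distrib, ← Finset.mul_sum]
    rw [hpow fun z => Q z * (1 + h z) ^ 2, hpow fun z => Q z * (1 - h z) ^ 2,
      hpow fun z => Q z * (1 - h z ^ 2)]
    have s1 : ∑ z, Q z * (1 + h z) ^ 2 = 1 + a := by
      calc _ = ∑ z, (Q z + 2 * (Q z * h z) + Q z * h z ^ 2) :=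
            Finset.sum_congr rfl fun z _ => by ring
        _ = 1 + a := by
          rw [Finset.sum_add_distrib, Finset.sum_add_distrib, ← Finset.mul_sum, hQ1, hQh, ← ha]
          ring
    have s2 : ∑ z, Q z * (1 - h z) ^ 2 = 1 + a := by
      calc _ = ∑ z, (Q z - 2 * (Q z * h z) + Q z * h z ^ 2) :=
            Finset.sum_congr rfl fun z _ => by ring
        _ = 1 + a := by
          rw [Finset.sum_add_distrib, Finset.sum_sub_distrib, ← Finset.mul_sum, hQ1, hQh, ← ha]
          ring
    have s3 : ∑ z, Q z * (1 - h z ^ 2) = 1 - a := by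
      simp only [mul_sub, mul_one, Finset.sum_sub_distrib, hQ1, ha]
    rw [s1, s2, s3]
    ring
  rw [hsq, hpow Q, hQ1, one_pow, one_mul] at hcs
  have hle : (∑ X : Fin n → Z, (∏ i, Q (X i)) * |D X|) ^ 2 ≤ 1 :=
    hcs.trans (two_mul_pow_sub_pow_le hn ha0 hvar)
  have heq : ∀ X : Fin n → Z, |∏ i, Q (X i) * (1 + h (X i)) - ∏ i, Q (X i) * (1 - h (X i))|
      = (∏ i, Q (X i)) * |D X| := by
    intro X
    rw [Finset.prod_mul_distrib, Finset.prod_mul_distrib, ← mul_sub, abs_mul,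
      abs_of_nonneg (hprod X)]
  simp only [heq]
  exact le_of_abs_le ((sq_le_one_iff_abs_le_one _).1 hle)

/-! ### The family of hard distributions -/

/-- The sign `±1` encoded by a Boolean. -/
def boolSign (b : Bool) : ℝ := if b then 1 else -1

@[simp] lemma boolSign_true : boolSign true = 1 := rfl

@[simp] lemma boolSign_false : boolSign false = -1 := rfl

@[simp] lemma boolSign_not (b : Bool) : boolSign (!b) = -boolSign b := by cases b <;> simp

lemma boolSign_eq (b : Bool) : boolSign b = 1 ∨ boolSign b = -1 := by cases b <;> simp

/-- The sample space of pairs of a coordinate and a sign. -/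
abbrev SignedCoord (d : ℕ) : Type u := ULift.{u} (Fin d × Bool)

instance (d : ℕ) : MeasurableSpace (SignedCoord.{u} d) := ⊤

/-- The density that picks the coordinate `j` with probability `p j` and a sign with mean `m j`. -/
def signedDensity {d : ℕ} (p m : Fin d → ℝ) (x : SignedCoord.{u} d) : ℝ :=
  p x.down.1 * ((1 + boolSign x.down.2 * m x.down.1) / 2)

/-- The absolute deviation loss in a random coordinate. -/
def signedLoss {d : ℕ} (γ : Seminorm ℝ (E d)) (r : Fin d → ℝ) (θ : E d) (x : SignedCoord.{u} d) :
    ℝ :=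
  |θ x.down.1 - boolSign x.down.2 * r x.down.1| / γ (EuclideanSpace.single x.down.1 1)

section Signed

variable {d : ℕ}

lemma sum_signedCoord (g : Fin d → Bool → ℝ) :
    ∑ x : SignedCoord.{u} d, g x.down.1 x.down.2 = ∑ j, (g j true + g j false) := by
  refine (Equiv.sum_comp Equiv.ulift fun z : Fin d × Bool => g z.1 z.2).trans ?_
  rw [Fintype.sum_prod_type]
  simp

lemma sum_signedDensity {p m : Fin d → ℝ} (hp : ∑ j, p j = 1) :
    ∑ x : SignedCoord.{u} d, signedDensity p m x = 1 := by
  simp only [signedDensity]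
  rw [sum_signedCoord (fun j b => p j * ((1 + boolSign b * m j) / 2))]
  refine (Finset.sum_congr rfl fun j _ => ?_).trans hp
  simp only [boolSign_true, boolSign_false]
  ring

lemma signedDensity_nonneg {p m : Fin d → ℝ} (hp : ∀ j, 0 ≤ p j) (hm : ∀ j, |m j| ≤ 1)
    (x : SignedCoord.{u} d) : 0 ≤ signedDensity p m x := by
  refine mul_nonneg (hp _) (div_nonneg ?_ zero_le_two)
  have := abs_le.1 (hm x.down.1)
  rcases boolSign_eq x.down.2 with h | h <;> rw [h] <;> linarith [this.1, this.2]

/-- Flipping the mean of one coordinate changes the `n`-fold product by at most `1` in `L¹`. -/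
lemma sum_abs_prod_signedDensity_sub_le {p m : Fin d → ℝ} (hp : ∀ j, 0 ≤ p j)
    (hp1 : ∑ j, p j = 1) (hm : ∀ j, |m j| ≤ 1) {n : ℕ} (hn : 1 ≤ n) (j : Fin d)
    (hj : n * (p j * m j ^ 2) ≤ 1 / (4 * Real.log 3)) :
    ∑ X : Fin n → SignedCoord.{u} d, |∏ i, signedDensity p m (X i)
      - ∏ i, signedDensity p (Function.update m j (-m j)) (X i)| ≤ 1 := by
  -- The midpoint of the two hypotheses: with the mean of coordinate `j` set to zero, they have
  -- densities `1 + h` and `1 - h` relative to it.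
  let m₀ : Fin d → ℝ := Function.update m j 0
  let h : SignedCoord.{u} d → ℝ := fun x => if x.down.1 = j then boolSign x.down.2 * m j else 0
  have hm₀ : ∀ i, |m₀ i| ≤ 1 := by
    intro i
    by_cases hi : i = j
    · subst hi
      simp [m₀]
    · simpa [m₀, Function.update_of_ne hi] using hm i
  have e1 : ∀ x, signedDensity p m x = signedDensity p m₀ x * (1 + h x) := by
    intro x
    by_cases hx : x.down.1 = j
    · simp [signedDensity, h, m₀, hx]
      ring
    · simp [signedDensity, h, m₀, hx]
  have e2 : ∀ x, signedDensity p (Function.update m j (-m j)) x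
      = signedDensity p m₀ x * (1 - h x) := by
    intro x
    by_cases hx : x.down.1 = j
    · simp [signedDensity, h, m₀, hx]
      ring
    · simp [signedDensity, h, m₀, hx]
  have s1 : ∑ x : SignedCoord.{u} d, signedDensity p m₀ x * h x = 0 := by
    simp only [signedDensity, h]
    rw [sum_signedCoord (fun i b => p i * ((1 + boolSign b * m₀ i) / 2) *
      (if i = j then boolSign b * m j else 0))]
    refine Finset.sum_eq_zero fun i _ => ?_
    by_cases hi : i = j
    · simp [hi, m₀]
    · simp [hi]
  have s2 : ∑ x : SignedCoord.{u} d, signedDensity p m₀ x * h x ^ 2 = p j * m j ^ 2 := by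
    simp only [signedDensity, h]
    rw [sum_signedCoord (fun i b => p i * ((1 + boolSign b * m₀ i) / 2) *
      (if i = j then boolSign b * m j else 0) ^ 2)]
    rw [Finset.sum_eq_single j (fun i _ hi => by simp [hi]) (by simp)]
    simp [m₀]
    ring
  simp only [e1, e2]
  exact sum_abs_prod_sub_prod_le (signedDensity_nonneg hp hm₀) (sum_signedDensity hp1) s1 hn
    (by rwa [s2])

/-- The mean vector with signs `v` and magnitudes `δ`. -/
def signedMean (δ : Fin d → ℝ) (v : Fin d → Bool) (j : Fin d) : ℝ := boolSign (v j) * δ j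

lemma abs_signedMean_le {δ : Fin d → ℝ} (hδ0 : ∀ j, 0 ≤ δ j) (hδ1 : ∀ j, δ j ≤ 1)
    (v : Fin d → Bool) (j : Fin d) : |signedMean δ v j| ≤ 1 := by
  rw [signedMean, abs_mul, abs_of_nonneg (hδ0 j)]
  rcases boolSign_eq (v j) with h | h <;> simp [h, hδ1 j]

/-- The indicator that the sign of `t` differs from the sign encoded by `b`. -/
def signError (b : Bool) (t : ℝ) : ℝ := if boolSign b * t ≤ 0 then 1 else 0

lemma signError_nonneg (b : Bool) (t : ℝ) : 0 ≤ signError b t := by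
  unfold signError
  split_ifs <;> norm_num

lemma one_le_signError_add (b : Bool) (t : ℝ) : 1 ≤ signError b t + signError (!b) t := by
  unfold signError
  rw [boolSign_not, neg_mul]
  rcases le_total (boolSign b * t) 0 with h | h
  · rw [if_pos h]
    split_ifs <;> norm_num
  · rw [if_pos (by linarith : -(boolSign b * t) ≤ 0)]
    split_ifs <;> norm_num

/-- On average over the signs, the error probability in each coordinate is at least `1 / 4`. -/
lemma quarter_le_sum_signError {p δ : Fin d → ℝ} (hp : ∀ j, 0 ≤ p j)
    (hp1 : ∑ j, p j = 1) (hδ0 : ∀ j, 0 ≤ δ j) (hδ1 : ∀ j, δ j ≤ 1) {n : ℕ} (hn : 1 ≤ n)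
    (j : Fin d) (hj : n * (p j * δ j ^ 2) ≤ 1 / (4 * Real.log 3))
    (T : (Fin n → SignedCoord.{u} d) → ℝ) :
    ∑ _v : Fin d → Bool, (1 / 4 : ℝ) ≤ ∑ v : Fin d → Bool, ∑ X : Fin n → SignedCoord.{u} d,
      (∏ i, signedDensity p (signedMean δ v) (X i)) * signError (v j) (T X) := by
  classical
  let N : (Fin d → Bool) → (Fin n → SignedCoord.{u} d) → ℝ := fun v X =>
    ∏ i, signedDensity p (signedMean δ v) (X i)
  have hN : ∀ v X, 0 ≤ N v X := fun v X => Finset.prod_nonneg fun i _ =>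
    signedDensity_nonneg hp (abs_signedMean_le hδ0 hδ1 v) _
  have hN1 : ∀ v, ∑ X, N v X = 1 := by
    intro v
    rw [← Fintype.sum_pow (fun x => signedDensity p (signedMean δ v) x) n,
      sum_signedDensity hp1, one_pow]
  let flip : (Fin d → Bool) → (Fin d → Bool) := fun v => Function.update v j (!v j)
  have hflip : Function.Involutive flip := by
    intro v
    simp [flip]
  have hflipmean : ∀ v, signedMean δ (flip v)
      = Function.update (signedMean δ v) j (-signedMean δ v j) := by
    intro v
    funext i
    by_cases hi : i = j
    · subst hi
      simp [signedMean, flip]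
    · simp [signedMean, flip, Function.update_of_ne hi]
  have hdist : ∀ v, ∑ X, |N v X - N (flip v) X| ≤ 1 := by
    intro v
    simp only [N, hflipmean]
    refine sum_abs_prod_signedDensity_sub_le hp hp1 (abs_signedMean_le hδ0 hδ1 v) hn j ?_
    have : signedMean δ v j ^ 2 = δ j ^ 2 := by
      rw [signedMean, mul_pow]
      rcases boolSign_eq (v j) with h | h <;> simp [h]
    rwa [this]
  let G : (Fin d → Bool) → ℝ := fun v => ∑ X, N v X * signError (v j) (T X)
  have hpair : ∀ v, 1 / 2 ≤ G v + G (flip v) := by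
    intro v
    -- Le Cam's two-point argument: every decision errs under `v` or under its flip, so the two
    -- errors together weigh at least the minimum of the two likelihoods.
    have hmin : ∀ X, (N v X + N (flip v) X - |N v X - N (flip v) X|) / 2
        ≤ N v X * signError (v j) (T X) + N (flip v) X * signError ((flip v) j) (T X) := by
      intro X
      have h1 := one_le_signError_add (v j) (T X)
      have h2 := signError_nonneg (v j) (T X)
      have h3 := signError_nonneg (!v j) (T X)
      have h4 : (flip v) j = !v j := by simp [flip]
      rw [h4]
      have h5 := hN v X
      have h6 := hN (flip v) X
      rcases le_total (N v X) (N (flip v) X) with h | h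
      · rw [abs_of_nonpos (by linarith)]
        nlinarith
      · rw [abs_of_nonneg (by linarith)]
        nlinarith
    have hs := Finset.sum_le_sum fun X (_ : X ∈ Finset.univ) => hmin X
    rw [← Finset.sum_div, Finset.sum_sub_distrib, Finset.sum_add_distrib, Finset.sum_add_distrib,
      hN1, hN1] at hs
    have := hdist v
    change 1 / 2 ≤ ∑ X, N v X * signError (v j) (T X)
      + ∑ X, N (flip v) X * signError (flip v j) (T X)
    linarith
  have hsum : ∑ v, G (flip v) = ∑ v, G v := Equiv.sum_comp hflip.toPerm G
  have htot := Finset.sum_le_sum fun v (_ : v ∈ Finset.univ) => hpair v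
  rw [Finset.sum_add_distrib, hsum] at htot
  change ∑ _v : Fin d → Bool, (1 / 4 : ℝ) ≤ ∑ v, G v
  have : ∑ _v : Fin d → Bool, (1 / 2 : ℝ) = 2 * ∑ _v : Fin d → Bool, (1 / 4 : ℝ) := by
    rw [Finset.mul_sum]
    norm_num
  linarith

/-! ### Properties of the hard loss -/

lemma single_pos {γ : Seminorm ℝ (E d)} (hγ : ∀ x, γ x = 0 → x = 0) (j : Fin d) :
    0 < γ (EuclideanSpace.single j 1) :=
  lt_of_le_of_ne (apply_nonneg γ _) fun h => by
    have h1 := hγ _ h.symm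
    have h2 := congrArg (fun x : E d => x j) h1
    simp at h2

/-- For a given observation the loss depends on a single coordinate `j`, with slope at most `1 /
γ(e_j)`. Its subgradients are therefore multiples of `e_j` of `γ`-norm at most one. -/
lemma signedLoss_mem_lossFamily {γ : Seminorm ℝ (E d)} (hγ : ∀ x, γ x = 0 → x = 0)
    (r : Fin d → ℝ) : signedLoss γ r ∈ lossFamily γ 1 (SignedCoord.{u} d) := by
  refine ⟨fun x => ?_, fun θ => measurable_from_top, fun x θ g hg => ?_⟩
  · refine ⟨convex_univ, fun θ _ τ _ a b ha hb hab => ?_⟩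
    simp only [signedLoss, PiLp.add_apply, PiLp.smul_apply, smul_eq_mul]
    rw [← mul_div_assoc, ← mul_div_assoc, ← add_div]
    refine div_le_div_of_nonneg_right ?_ (apply_nonneg γ _)
    set c := boolSign x.down.2 * r x.down.1
    calc |a * θ x.down.1 + b * τ x.down.1 - c|
        = |a * (θ x.down.1 - c) + b * (τ x.down.1 - c)| := by
          congr 1
          linear_combination c * hab
      _ ≤ |a * (θ x.down.1 - c)| + |b * (τ x.down.1 - c)| := abs_add_le _ _
      _ = a * |θ x.down.1 - c| + b * |τ x.down.1 - c| := by
          rw [abs_mul, abs_mul, abs_of_nonneg ha, abs_of_nonneg hb]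
  · obtain ⟨⟨j, b⟩⟩ := x
    have hpos := single_pos hγ j
    set w := γ (EuclideanSpace.single j 1) with hw
    have hstep : ∀ (i : Fin d) (s : ℝ), signedLoss γ r θ ⟨(j, b)⟩ + s * g i
        ≤ signedLoss γ r (θ + EuclideanSpace.single i s) ⟨(j, b)⟩ := by
      intro i s
      have h := hg (θ + EuclideanSpace.single i s)
      simpa [add_sub_cancel_left, EuclideanSpace.inner_single_right] using h
    have hoff : ∀ i, i ≠ j → g i = 0 := by
      intro i hi
      have h1 := hstep i 1
      have h2 := hstep i (-1)
      simp [signedLoss, hi.symm] at h1 h2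
      linarith
    have hj : |g j| ≤ 1 / w := by
      have hb : ∀ s : ℝ, |s| = 1 → s * g j ≤ 1 / w := by
        intro s hs
        have h := hstep j s
        simp only [signedLoss, PiLp.add_apply, PiLp.single_apply, if_true, ← hw] at h
        have h2 : |θ j + s - boolSign b * r j| ≤ |θ j - boolSign b * r j| + 1 := by
          have := abs_add_le (θ j - boolSign b * r j) s
          rwa [hs, sub_add_eq_add_sub] at this
        have h3 := div_le_div_of_nonneg_right h2 hpos.le
        rw [add_div] at h3
        linarith
      have h1 := hb 1 (by simp)
      have h2 := hb (-1) (by simp)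
      exact abs_le.2 ⟨by linarith, by linarith⟩
    have hgeq : g = g j • EuclideanSpace.single j (1 : ℝ) := by
      ext i
      by_cases hi : i = j
      · subst hi
        simp
      · simp [hi, hoff i hi]
    rw [hgeq, map_smul_eq_mul, ← hw, Real.norm_eq_abs]
    calc |g j| * w ≤ 1 / w * w := mul_le_mul_of_nonneg_right hj hpos.le
      _ = 1 := one_div_mul_cancel hpos.ne'

/-- Excess absolute deviation caused by an error in the sign. -/
lemma signError_mul_le {t r δ : ℝ} (b : Bool) (hδ0 : 0 ≤ δ) (hδ1 : δ ≤ 1) :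
    δ * r * signError b t ≤ ((1 + boolSign b * δ) / 2 * |t - r| + (1 - boolSign b * δ) / 2 * |t + r|)
      - (1 - δ) * r := by
  have h1 := le_abs_self (t - r)
  have h2 := neg_le_abs (t - r)
  have h3 := le_abs_self (t + r)
  have h4 := neg_le_abs (t + r)
  have hp : 0 ≤ (1 + δ) / 2 := by linarith
  have hm : 0 ≤ (1 - δ) / 2 := by linarith
  have k1 := mul_nonneg hδ0 (abs_nonneg (t - r))
  have k2 := mul_nonneg hδ0 (abs_nonneg (t + r))
  have m1 := mul_le_mul_of_nonneg_left h1 hm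
  have m2 := mul_le_mul_of_nonneg_left h2 hm
  have m3 := mul_le_mul_of_nonneg_left h3 hm
  have m4 := mul_le_mul_of_nonneg_left h4 hm
  -- With a wrong sign, dropping both absolute values in the favourable direction leaves at least
  -- `r`. With a right sign, only `|t - r| + |t + r| ≥ 2 * r` is needed.
  by_cases h : boolSign b * t ≤ 0
  · rw [signError, if_pos h]
    have h5 := mul_nonneg hδ0 (neg_nonneg.2 h)
    have p2 := mul_le_mul_of_nonneg_left h2 hp
    have p3 := mul_le_mul_of_nonneg_left h3 hp
    rcases boolSign_eq b with hb | hb <;> rw [hb] at h5 ⊢ <;> linarith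
  · rw [signError, if_neg h]
    rcases boolSign_eq b with hb | hb <;> rw [hb] <;> linarith

/-- A finitely supported probability measure with prescribed weights. -/
lemma exists_probabilityMeasure_real_singleton {Z : Type u} [Fintype Z] [MeasurableSpace Z]
    [MeasurableSingletonClass Z] {w : Z → ℝ} (hw : ∀ z, 0 ≤ w z) (hw1 : ∑ z, w z = 1) :
    ∃ P : ProbabilityMeasure Z, ∀ z, (P : Measure Z).real {z} = w z := by
  let q : PMF Z := PMF.ofFintype (fun z => ENNReal.ofReal (w z)) (by
    rw [← ENNReal.ofReal_sum_of_nonneg fun z _ => hw z, hw1, ENNReal.ofReal_one])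
  refine ⟨⟨q.toMeasure, inferInstance⟩, fun z => ?_⟩
  change (q.toMeasure {z}).toReal = w z
  rw [q.toMeasure_apply_singleton z (measurableSet_singleton z)]
  simp [q, ENNReal.toReal_ofReal (hw z)]

/-- Lower bound on the minimax risk through sign estimation in each coordinate. -/
lemma sum_le_minimaxRisk {γ : Seminorm ℝ (E d)} (hγ : ∀ x, γ x = 0 → x = 0) {n : ℕ} (hn : 1 ≤ n)
    {Θ : Set (E d)} (hortho : Orthosymmetric Θ) {θ₀ : E d} (hθ₀ : θ₀ ∈ Θ) {p δ : Fin d → ℝ}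
    (hp : ∀ j, 0 ≤ p j) (hp1 : ∑ j, p j = 1) (hδ0 : ∀ j, 0 ≤ δ j) (hδ1 : ∀ j, δ j ≤ 1)
    (hnp : ∀ j, n * (p j * δ j ^ 2) ≤ 1 / (4 * Real.log 3)) :
    ((1 / 4 * ∑ j, p j * δ j * (|θ₀ j| / γ (EuclideanSpace.single j 1)) : ℝ) : EReal)
      ≤ minimaxRisk.{u} n Θ γ := by
  classical
  let r : Fin d → ℝ := fun j => |θ₀ j|
  let w : Fin d → ℝ := fun j => γ (EuclideanSpace.single j 1)
  have hw : ∀ j, 0 < w j := single_pos hγ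
  let F : E d → SignedCoord.{u} d → ℝ := signedLoss γ r
  have hmean := abs_signedMean_le hδ0 hδ1
  choose P hP using fun v : Fin d → Bool => exists_probabilityMeasure_real_singleton
    (signedDensity_nonneg.{u} hp (hmean v)) (sum_signedDensity hp1)
  have hloss : ∀ v θ, expectedLoss F (P v) θ = ∑ j, p j / w j *
      ((1 + boolSign (v j) * δ j) / 2 * |θ j - r j|
        + (1 - boolSign (v j) * δ j) / 2 * |θ j + r j|) := by
    intro v θ
    rw [expectedLoss, integral_fintype Integrable.of_finite]
    simp only [hP, smul_eq_mul, signedDensity, F, signedLoss, signedMean]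
    rw [sum_signedCoord (fun j b => p j * ((1 + boolSign b * (boolSign (v j) * δ j)) / 2) *
      (|θ j - boolSign b * r j| / γ (EuclideanSpace.single j 1)))]
    refine Finset.sum_congr rfl fun j _ => ?_
    simp only [boolSign_true, boolSign_false, one_mul, neg_mul, sub_neg_eq_add, w]
    ring
  have hopt : ∀ v, ⨅ θ : Θ, expectedLoss F (P v) θ ≤ ∑ j, p j / w j * ((1 - δ j) * r j) := by
    intro v
    -- The comparator carrying the true signs is a reflection of `θ₀`.
    have hmem : (WithLp.toLp 2 (fun j => boolSign (v j) * r j) : E d) ∈ Θ := by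
      have h := hortho θ₀ hθ₀ (fun j => boolSign (v j) * (if 0 ≤ θ₀ j then 1 else -1)) (fun j => by
        rcases boolSign_eq (v j) with h | h <;> by_cases h' : 0 ≤ θ₀ j <;> simp [h, h'])
      convert h using 3 with j
      by_cases h' : 0 ≤ θ₀ j
      · simp [r, h', abs_of_nonneg h']
      · simp [r, h', abs_of_neg (not_le.1 h')]
    refine (ciInf_le ⟨0, ?_⟩ (⟨_, hmem⟩ : Θ)).trans (le_of_eq ?_)
    · rintro _ ⟨θ, rfl⟩
      exact integral_nonneg fun x => div_nonneg (abs_nonneg _) (apply_nonneg γ _)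
    · rw [hloss]
      refine Finset.sum_congr rfl fun j _ => ?_
      congr 1
      have hr : 0 ≤ r j := abs_nonneg _
      have h2 : |(2 : ℝ) * r j| = 2 * r j := abs_of_nonneg (by linarith)
      have e1 : r j + r j = 2 * r j := by ring
      have e2 : -r j - r j = -(2 * r j) := by ring
      change (1 + boolSign (v j) * δ j) / 2 * |boolSign (v j) * r j - r j|
        + (1 - boolSign (v j) * δ j) / 2 * |boolSign (v j) * r j + r j| = (1 - δ j) * r j
      rcases boolSign_eq (v j) with h | h
      · rw [h, one_mul, one_mul, sub_self, abs_zero, e1, h2]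
        ring
      · rw [h, neg_one_mul, neg_one_mul, e2, abs_neg, h2, neg_add_cancel, abs_zero]
        ring
  have hexcess : ∀ v θ, ∑ j, p j * δ j * (r j / w j) * signError (v j) (θ j)
      ≤ expectedLoss F (P v) θ - ⨅ θ : Θ, expectedLoss F (P v) θ := by
    intro v θ
    have h1 : ∑ j, p j * δ j * (r j / w j) * signError (v j) (θ j)
        ≤ expectedLoss F (P v) θ - ∑ j, p j / w j * ((1 - δ j) * r j) := by
      rw [hloss, ← Finset.sum_sub_distrib]
      refine Finset.sum_le_sum fun j _ => ?_
      rw [← mul_sub]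
      have h := mul_le_mul_of_nonneg_left
        (signError_mul_le (t := θ j) (r := r j) (v j) (hδ0 j) (hδ1 j))
        (div_nonneg (hp j) (hw j).le)
      refine le_trans (le_of_eq ?_) h
      ring
    linarith [hopt v]
  refine le_iSup_of_le (SignedCoord.{u} d) (le_iSup_of_le inferInstance
    (le_iSup_of_le (Set.range P) (le_iInf₂ fun est _ => ?_)))
  let T := est F
  -- The sign bound holds on average over `v`, so some `v` is bad for the given procedure.
  obtain ⟨v, -, hv⟩ := Finset.exists_le_of_sum_le (s := (Finset.univ : Finset (Fin d → Bool)))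
    Finset.univ_nonempty (f := fun _ => 1 / 4 * ∑ j, p j * δ j * (r j / w j))
    (g := fun v => ∑ j, p j * δ j * (r j / w j) * ∑ X : Fin n → SignedCoord.{u} d,
      (∏ i, signedDensity p (signedMean δ v) (X i)) * signError (v j) (T X j)) (by
    rw [Finset.sum_comm]
    simp only [← Finset.mul_sum]
    rw [Finset.sum_const, nsmul_eq_mul, mul_left_comm, ← mul_assoc, Finset.mul_sum]
    refine Finset.sum_le_sum fun j _ => ?_
    have h := quarter_le_sum_signError.{u} hp hp1 hδ0 hδ1 hn j (hnp j) (fun X => T X j)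
    rw [Finset.sum_const, nsmul_eq_mul] at h
    have h2 : 0 ≤ p j * δ j * (r j / w j) :=
      mul_nonneg (mul_nonneg (hp j) (hδ0 j)) (div_nonneg (abs_nonneg _) (hw j).le)
    have := mul_le_mul_of_nonneg_left h h2
    linarith)
  refine le_iSup₂_of_le F (signedLoss_mem_lossFamily hγ r) (le_iSup₂_of_le (P v) ⟨v, rfl⟩
    (le_iSup_of_le (fun θ => Integrable.of_finite) ?_))
  rw [extExpectation_eq_integral Integrable.of_finite, EReal.coe_le_coe_iff,
    integral_fintype Integrable.of_finite]
  have hpi : ∀ X : Fin n → SignedCoord.{u} d,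
      (Measure.pi fun _ : Fin n => (P v : Measure (SignedCoord.{u} d))).real {X}
        = ∏ i, signedDensity p (signedMean δ v) (X i) := by
    intro X
    rw [Measure.real, Measure.pi_singleton, ENNReal.toReal_prod]
    exact Finset.prod_congr rfl fun i _ => hP v (X i)
  simp only [hpi, smul_eq_mul]
  refine hv.trans ?_
  simp only [Finset.mul_sum]
  rw [Finset.sum_comm]
  refine Finset.sum_le_sum fun X _ => ?_
  have hN : 0 ≤ ∏ i, signedDensity p (signedMean δ v) (X i) :=
    Finset.prod_nonneg fun i _ => signedDensity_nonneg hp (hmean v) _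
  refine le_trans (le_of_eq ?_) (mul_le_mul_of_nonneg_left (hexcess v (T X)) hN)
  rw [Finset.mul_sum]
  exact Finset.sum_congr rfl fun j _ => by ring

end Signed

/-! ### Optimizing the hard distributions -/

lemma minimaxRisk_nonneg {d : ℕ} (n : ℕ) (Θ : Set (E d)) (γ : Seminorm ℝ (E d)) :
    0 ≤ minimaxRisk.{u} n Θ γ := by
  refine le_iSup_of_le PUnit (le_iSup_of_le ⊤ (le_iSup_of_le Set.univ (le_iInf₂ fun est _ => ?_)))
  let _ : MeasurableSpace PUnit.{u + 1} := ⊤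
  refine le_iSup₂_of_le _ (zero_mem_lossFamily γ PUnit) (le_iSup₂_of_le
    ⟨Measure.dirac PUnit.unit, inferInstance⟩ trivial
    (le_iSup_of_le (fun _ => integrable_zero _ _ _) ?_))
  simp [expectedLoss, extExpectation]

/-- The lower bound on the minimax risk given by one vector with at most `k` nonzero coordinates. -/
lemma mul_norm_scaled_le_minimaxRisk {d : ℕ} {γ : Seminorm ℝ (E d)} (hγ : ∀ x, γ x = 0 → x = 0)
    {n : ℕ} (hn : 1 ≤ n) {Θ : Set (E d)} (hortho : Orthosymmetric Θ) {θ : E d} (hθ : θ ∈ Θ) {k : ℕ}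
    (hk : l0 θ ≤ k) :
    ((1 / (8 * √(n * Real.log 3)) * (1 - k / (n * Real.log 3)) * ‖scaled γ θ‖ : ℝ) : EReal)
      ≤ minimaxRisk.{u} n Θ γ := by
  classical
  set A := ‖scaled γ θ‖ with hA
  rcases (norm_nonneg (scaled γ θ)).eq_or_lt with h0 | hApos
  · rw [hA, ← h0, mul_zero]
    exact minimaxRisk_nonneg n Θ γ
  rw [← hA] at hApos
  have hn0 : (0 : ℝ) < n := by exact_mod_cast hn
  have hlog : 0 < Real.log 3 := Real.log_pos (by norm_num)
  set B := n * Real.log 3 with hB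
  have hBpos : 0 < B := mul_pos hn0 hlog
  have hsB : 0 < √B := Real.sqrt_pos.2 hBpos
  have hsBB : √B ^ 2 = B := Real.sq_sqrt hBpos.le
  set w : Fin d → ℝ := fun j => γ (EuclideanSpace.single j 1) with hw
  have hwpos : ∀ j, 0 < w j := single_pos hγ
  set a : Fin d → ℝ := fun j => |θ j| / w j with ha
  have ha0 : ∀ j, 0 ≤ a j := fun j => div_nonneg (abs_nonneg _) (hwpos j).le
  have hsum : ∑ j, a j ^ 2 = A ^ 2 := by
    rw [hA, EuclideanSpace.norm_sq_eq]
    refine Finset.sum_congr rfl fun j _ => ?_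
    rw [Real.norm_eq_abs]
    simp only [scaled, ha]
    rw [abs_div, abs_of_pos (hwpos j)]
  set p : Fin d → ℝ := fun j => a j ^ 2 / A ^ 2 with hp
  have hp0 : ∀ j, 0 ≤ p j := fun j => by positivity
  have hp1 : ∑ j, p j = 1 := by
    rw [hp, ← Finset.sum_div, hsum, div_self (by positivity)]
  -- The size of `δ j` is chosen so that `B * p j * δ j ^ 2 = 1/4`, which saturates the testing
  -- condition. The cutoff `1 ≤ B * p j` ensures `δ j ≤ 1`.
  set δ : Fin d → ℝ := fun j => if 1 ≤ B * p j then A / (2 * a j * √B) else 0 with hδ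
  have hapos : ∀ j, 1 ≤ B * p j → 0 < a j := by
    intro j hj
    refine lt_of_le_of_ne (ha0 j) fun h => ?_
    simp only [hp, ← h] at hj
    norm_num at hj
  have hBpδ : ∀ j, 1 ≤ B * p j → B * (p j * δ j ^ 2) = 1 / 4 := by
    intro j hj
    have := hapos j hj
    have e : δ j = A / (2 * a j * √B) := if_pos hj
    rw [e, div_pow, mul_pow, mul_pow, hsBB]
    change B * (a j ^ 2 / A ^ 2 * _) = _
    field_simp
    norm_num
  have hδ0 : ∀ j, 0 ≤ δ j := by
    intro j
    simp only [hδ]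
    split_ifs
    · have := ha0 j
      positivity
    · exact le_rfl
  have hδ1 : ∀ j, δ j ≤ 1 := by
    intro j
    by_cases hj : 1 ≤ B * p j
    · have h1 := hBpδ j hj
      have h2 := hδ0 j
      by_contra! h3
      nlinarith
    · simp [hδ, if_neg hj]
  have hnp : ∀ j, n * (p j * δ j ^ 2) ≤ 1 / (4 * Real.log 3) := by
    intro j
    rw [le_div_iff₀ (by positivity)]
    by_cases hj : 1 ≤ B * p j
    · have h1 := hBpδ j hj
      rw [hB] at h1
      linarith
    · simp [hδ, if_neg hj]
  refine le_trans (EReal.coe_le_coe_iff.2 ?_)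
    (sum_le_minimaxRisk.{u} hγ hn hortho hθ hp0 hp1 hδ0 hδ1 hnp)
  -- A kept coordinate contributes `A / (2 * √B) * p j` exactly. A dropped one has `p j < 1 / B`, so
  -- over the support of `θ` the loss is at most `k / B` of the total weight.
  have hterm : ∀ j, A / (2 * √B) * (p j - if θ j ≠ 0 then 1 / B else 0)
      ≤ p j * δ j * (|θ j| / γ (EuclideanSpace.single j 1)) := by
    intro j
    change _ ≤ p j * δ j * a j
    by_cases hj : 1 ≤ B * p j
    · have h1 := hapos j hj
      have h2 : p j * δ j * a j = A / (2 * √B) * p j := by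
        simp only [hδ, if_pos hj]
        field_simp
      rw [h2]
      refine mul_le_mul_of_nonneg_left ?_ (by positivity)
      split_ifs
      · have : 0 < 1 / B := by positivity
        linarith
      · linarith
    · have h2 : p j * δ j * a j = 0 := by simp [hδ, if_neg hj]
      rw [h2]
      refine mul_nonpos_of_nonneg_of_nonpos (by positivity) ?_
      by_cases h : θ j = 0
      · simp [h, hp, ha]
      · rw [if_pos h]
        have : p j < 1 / B := by
          rw [lt_div_iff₀ hBpos]
          linarith
        linarith
  have hS := Finset.sum_le_sum fun j (_ : j ∈ Finset.univ) => hterm j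
  rw [← Finset.mul_sum, Finset.sum_sub_distrib, hp1] at hS
  have hcard : ∑ j, (if θ j ≠ 0 then 1 / B else 0) ≤ k / B := by
    rw [← Finset.sum_filter, Finset.sum_const, nsmul_eq_mul, mul_one_div]
    have : ((l0 θ : ℕ) : ℝ) ≤ k := by exact_mod_cast hk
    exact div_le_div_of_nonneg_right this hBpos.le
  have hc : 0 ≤ A / (2 * √B) := by positivity
  have hfin : A / (2 * √B) * (1 - k / B) ≤ A / (2 * √B) * (1 - ∑ j, (if θ j ≠ 0 then 1 / B else 0)) :=
    mul_le_mul_of_nonneg_left (by linarith) hc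
  have he : 1 / (8 * √B) * (1 - k / B) * A = 1 / 4 * (A / (2 * √B) * (1 - k / B)) := by
    field_simp
    ring
  rw [he]
  linarith

/-! ### Facts about the suprema in the final bounds -/

lemma zero_mem_of_orthosymmetric {d : ℕ} {Θ : Set (E d)} (hne : Θ.Nonempty)
    (hortho : Orthosymmetric Θ) (hconv : Convex ℝ Θ) : (0 : E d) ∈ Θ := by
  obtain ⟨θ, hθ⟩ := hne
  have hneg := hortho θ hθ (fun _ => -1) (fun _ => Or.inr rfl)
  have h := hconv hθ hneg (a := 1 / 2) (b := 1 / 2) (by norm_num) (by norm_num) (by norm_num)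
  convert h using 1
  ext j
  simp

/-- The supremum of `⟨θ, g⟩` over `Θ` and the quadratic hull is a real number. -/
lemma exists_coe_eq_iSup_inner {d : ℕ} {Θ : Set (E d)} (hne : Θ.Nonempty)
    (hbdd : Bornology.IsBounded Θ) (γ : Seminorm ℝ (E d)) (hγ : ∀ x, γ x = 0 → x = 0) :
    ∃ s : ℝ, (⨆ θ ∈ Θ, ⨆ g ∈ qHull (normBall γ 0 1), ((inner ℝ θ g : ℝ) : EReal)) = (s : EReal) := by
  obtain ⟨R, -, hR⟩ := exists_bound_qHull_normBall γ hγ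
  obtain ⟨R', hR'⟩ := hbdd.exists_norm_le
  have hR0 : 0 ≤ R' := by
    obtain ⟨θ, hθ⟩ := hne
    exact (norm_nonneg θ).trans (hR' θ hθ)
  set S := ⨆ θ ∈ Θ, ⨆ g ∈ qHull (normBall γ 0 1), ((inner ℝ θ g : ℝ) : EReal)
  have hle : ∀ θ ∈ Θ, ∀ g ∈ qHull (normBall γ 0 1), ((inner ℝ θ g : ℝ) : EReal) ≤ S :=
    fun θ hθ g hg => le_iSup₂_of_le θ hθ (le_iSup₂_of_le g hg le_rfl)
  have htop : S ≤ ((∑ _j : Fin d, R' * R : ℝ) : EReal) := by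
    refine iSup₂_le fun θ hθ => iSup₂_le fun g hg => EReal.coe_le_coe_iff.2 ?_
    rw [PiLp.inner_apply]
    refine Finset.sum_le_sum fun j _ => ?_
    calc inner ℝ (θ j) (g j) ≤ ‖θ j‖ * ‖g j‖ := real_inner_le_norm _ _
      _ ≤ R' * R := mul_le_mul ((PiLp.norm_apply_le θ j).trans (hR' θ hθ)) (hR g hg j)
          (norm_nonneg _) hR0
  have hbot : S ≠ ⊥ := by
    obtain ⟨θ, hθ⟩ := hne
    have h0 : (0 : E d) ∈ qHull (normBall γ 0 1) :=
      (qHull_isLeast (normBall γ 0 1)).1.1 (by simp [normBall])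
    intro h
    have := hle θ hθ 0 h0
    rw [h, le_bot_iff] at this
    exact EReal.coe_ne_bot _ this
  exact ⟨S.toReal, (EReal.coe_toReal (ne_top_of_le_ne_top (EReal.coe_ne_top _) htop) hbot).symm⟩

end QCMinimax
end

theorem mainTheorem2 {d : ℕ} (n : ℕ) (hn : 1 ≤ n) (Θ : Set (QCMinimax.E d))
    (hne : Θ.Nonempty) (hortho : QCMinimax.Orthosymmetric Θ)
    (hqc : QCMinimax.QuadraticallyConvex Θ) (hconv : Convex ℝ Θ) (hcomp : IsCompact Θ)
    (γ : Seminorm ℝ (QCMinimax.E d)) (hγ : ∀ x, γ x = 0 → x = 0) :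
    (∀ k : ℕ,
      ((1 / (8 * √(n * Real.log 3)) * (1 - k / (n * Real.log 3)) : ℝ) : EReal) *
          (⨆ θ ∈ Θ, ⨆ (_ : QCMinimax.l0 θ ≤ k), ((‖QCMinimax.scaled γ θ‖ : ℝ) : EReal)) ≤
        QCMinimax.minimaxRisk.{u} n Θ γ) ∧
    QCMinimax.minimaxRisk.{u} n Θ γ ≤ QCMinimax.minimaxRegret.{u} n Θ γ ∧
    QCMinimax.minimaxRegret.{u} n Θ γ ≤
      ((1 / √n : ℝ) : EReal) *
        (⨆ θ ∈ Θ, ⨆ g ∈ QCMinimax.qHull (QCMinimax.normBall γ 0 1),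
          ((inner ℝ θ g : ℝ) : EReal)) := by
  refine ⟨fun k => ?_, ?_, ?_⟩
  · set c := 1 / (8 * √(n * Real.log 3)) * (1 - k / (n * Real.log 3))
    rcases le_or_gt c 0 with hc | hc
    · refine le_trans ?_ (QCMinimax.minimaxRisk_nonneg n Θ γ)
      -- When `k` is large the factor is not positive and the bound is trivial, provided the
      -- supremum is nonnegative; the vector `0 ∈ Θ` guarantees this for every `k`.
      refine EReal.mul_nonpos_iff.2 (Or.inr ⟨EReal.coe_nonpos.2 hc, ?_⟩)
      refine le_iSup₂_of_le 0 (QCMinimax.zero_mem_of_orthosymmetric hne hortho hconv)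
        (le_iSup_of_le (by simp [QCMinimax.l0]) ?_)
      exact EReal.coe_nonneg.2 (norm_nonneg _)
    -- Dividing by the positive constant frees the supremum, which can then be bounded one `θ` at a
    -- time.
    · rw [mul_comm, ← EReal.le_div_iff_mul_le (EReal.coe_pos.2 hc) (EReal.coe_ne_top _)]
      refine iSup₂_le fun θ hθ => iSup_le fun hk => ?_
      rw [EReal.le_div_iff_mul_le (EReal.coe_pos.2 hc) (EReal.coe_ne_top _), ← EReal.coe_mul,
        mul_comm]
      exact QCMinimax.mul_norm_scaled_le_minimaxRisk hγ hn hortho hθ hk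
  · exact iSup_mono fun 𝒳 => iSup_mono fun _ => iSup_le fun Ps =>
      QCMinimax.minimaxRiskOf_le_minimaxRegretOf hn hne hcomp.isBounded hγ Ps
  · obtain ⟨s, hs⟩ := QCMinimax.exists_coe_eq_iSup_inner hne hcomp.isBounded γ hγ
    rw [hs, ← EReal.coe_mul]
    refine iSup_le fun 𝒳 => iSup_le fun _ =>
      QCMinimax.minimaxRegretOf_le hn hne hortho hqc hcomp hγ 𝒳 fun θ hθ g hg => ?_
    rw [← EReal.coe_le_coe_iff, ← hs]
    exact le_iSup₂_of_le θ hθ (le_iSup₂_of_le g hg le_rfl)
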